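/- Let $n\ge 1$ be an integer. For $f,g\in\mathbb Z[x]$, put, with $w=e^{2\pi i/(2n)}$ and $z_j=w^j$, $$M_G\big(f(x)+y\,g(x)\big)=\prod_{j=0}^{2n-1}\Big(f(z_j)f(z_j^{-1})-z_j^{\,n}g(z_j)g(z_j^{-1})\Big);$$ this is the dicyclic (Lind--Mahler) measure of $F=f(x)+y\,g(x)$ for the dicyclic group $G=Q_{4n}=\langle x,y : x^{2n}=1,\ y^2=x^n,\ xy=yx^{-1}\rangle$ of order $4n$, and it is a rational integer. We write $p^a\,\|\,k$ if $p^a\mid k$ and $p^{a+1}\nmid k$. (i) Let $p$ be an odd prime and $p^{\alpha}\,\|\,n$, $\alpha\ge 0$. If $p\mid M_G(F)$ then $p^{2\alpha+1}\mid M_G(F)$. The exponent $2\alpha+1$ is best possible (for every such $n$ and $p$ it cannot be replaced by a larger one); for example $$p^{2\alpha+1}\ \Big\|\ M_G\Big(1-(1+x^n)(1-x)+y\,\tfrac{p-1}{2}\,(1+x^n)\Big).$$ (ii) Let $2^{\alpha}\,\|\,n$, $\alpha\ge 0$, and suppose that $2\mid M_G(F)$. (a) If $\alpha=0$ then $2^4\mid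 M_G(F)$. (b) If $\alpha\ge 1$ then $2^{2\alpha+6}\mid M_G(F)$. For every such $n$, the exponents in (a) and (b) are optimal (they cannot be replaced by larger ones). Moreover, for every $\alpha\ge0$ with $2^\alpha\,\|\,n$ and every integer $m$, $$M_G\Big(x^{2^{\alpha+1}}+1+m\,\tfrac{x^{2n}-1}{x-1}+y\,m\,\tfrac{x^{2n}-1}{x-1}\Big)=2^{2^{\alpha+2}}(1+2mn),$$ and $$2^{2\alpha+6}\ \big\|\ M_G\big(4+(x-1)\big).$$ -/

import Mathlib

open Polynomial

noncomputable section

/-- The Lind-Mahler measure `M_{ℤ_N}(F) = ∏_{j=0}^{N-1} F(w_N^j)`, `w_N = e^{2πi/N}`, of a function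
`F` on the `N`-th roots of unity. -/
def cyclicMeasure (N : ℕ) (F : ℂ → ℂ) : ℂ :=
  ∏ j ∈ Finset.range N, F (Complex.exp (2 * Real.pi * Complex.I / N) ^ j)

/-- The measure `M_G(f(x) + y g(x)) = M_{ℤ_{2n}}(f(x) f(x⁻¹) - x^n g(x) g(x⁻¹))` of the dicyclic
group `G = Q_{4n} = ⟨x, y : x^{2n} = 1, y² = x^n, xy = yx⁻¹⟩`. -/
def dicyclicMeasure (n : ℕ) (f g : ℤ[X]) : ℂ :=
  cyclicMeasure (2 * n) fun z =>
    aeval z f * aeval z⁻¹ f - z ^ n * (aeval z g * aeval z⁻¹ g)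

/-- The complex number `z` is a rational integer divisible, in `ℤ`, by `d`. -/
def IntDvd (d : ℤ) (z : ℂ) : Prop := ∃ k : ℤ, z = ((d * k : ℤ) : ℂ)

/-- `p^e ∥ z`: the complex number `z` is a rational integer divisible, in `ℤ`, by `p^e` but not
by `p^(e+1)`. -/
def IntExactPow (p e : ℕ) (z : ℂ) : Prop :=
  IntDvd ((p : ℤ) ^ e) z ∧ ¬ IntDvd ((p : ℤ) ^ (e + 1)) z

/-- `p^e ∥ n` for natural numbers. -/
def ExactPow (p e n : ℕ) : Prop := p ^ e ∣ n ∧ ¬ p ^ (e + 1) ∣ n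

/-- The polynomial `(x^N - 1)/(x - 1) = 1 + x + ⋯ + x^{N-1}`. -/
def geomPoly (N : ℕ) : ℤ[X] := ∑ i ∈ Finset.range N, X ^ i

end

/-! The factor of the measure at `z` is unchanged under `z ↦ z⁻¹`, so away from `z = ±1` it is the
value of an integer polynomial `h` (`measurePoly`) at `t = z + z⁻¹`. The numbers `t` are the roots
of the Chebyshev polynomial `S_{n-1}`, hence `M = (f(1)² - g(1)²)(f(-1)² - (-1)ⁿ g(-1)²)
Res(S_{n-1}, h)²` (`dicyclicMeasure_eq`).

For a prime `p` and `n = p^a r`, `S_{n-1}` is `S_{r-1}` times `a` factors `S_{p-1} ∘ C_m`. Modulo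
`p` the square of each is a power of `(X² - 4) S_{m-1}²`, so its resultant with `h` is divisible by
`p` exactly when `p ∣ h(2) h(-2) Res(S_{r-1}, h)`. For `a ≥ 1`, `h(±2)` agree modulo `p` with the
two outer factors of `M`. So `p ∣ M` makes all `a` resultants divisible by `p`; after squaring they
give `p^{2a}`, and the remaining factors give one more `p` (`prime_pow_dvd_measure`).

For `p = 2` and `n = 2^{a+1}(2k+1)`, use `S_{2m-1} = S_{m-1} C_m` and `S_{2k} = V W`, where `V =
oddMinus k` and `W = oddPlus k` agree modulo 2. The factors `C_{2^i(2k+1)}` with `1 ≤ i ≤ a` supply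
`2^{2a}`. The missing `2^8` comes from the outer factors and `h(0)` if `h(0)` is even
(`two_pow_eight_dvd_of_even`), and otherwise from `16 ∣ Res(V,h) Res(W,h) Res(C_{2k+1},h)`
(`sixteen_dvd_res_odd`). The latter rests on the fact that a monic polynomial without roots modulo
`p` shares with `h` modulo `p` a factor of degree at least 2, or none (`sq_dvd_res_of_no_root`).

Sharpness is read off from explicit values: `(9ⁿ - 1)²` and `16` for the prime 2, and `2ⁿ(C_n(s) -
2)` with `s = (4 + 2p - p²)/2` for odd `p`, where `C_p(2+t) - 2 = t V(2+t)²` raises the valuation by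
exactly 2. -/

/-! ### Resultants and their divisibility by primes. -/

/-- The resultant of two integer polynomials, in their actual degrees. -/
noncomputable def res (Q h : ℤ[X]) : ℤ := Q.resultant h

lemma res_mul {Q₁ Q₂ : ℤ[X]} (h₁ : Q₁ ≠ 0) (h₂ : Q₂ ≠ 0) (h : ℤ[X]) :
    res (Q₁ * Q₂) h = res Q₁ h * res Q₂ h := by
  unfold res
  rw [natDegree_mul h₁ h₂, resultant_mul_left _ _ _ _ le_rfl]

lemma res_one (h : ℤ[X]) : res 1 h = 1 := by simp [res]

lemma res_pow {Q : ℤ[X]} (hQ : Q ≠ 0) (h : ℤ[X]) (k : ℕ) : res (Q ^ k) h = res Q h ^ k := by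
  induction k with
  | zero => simp [res_one]
  | succ k ih => rw [pow_succ, res_mul (pow_ne_zero _ hQ) hQ, ih, pow_succ]

lemma res_X_sub_C (c : ℤ) (h : ℤ[X]) : res (X - C c) h = h.eval c := by
  unfold res
  rw [natDegree_X_sub_C, resultant_X_sub_C_left _ _ _ le_rfl]

lemma res_X (h : ℤ[X]) : res X h = h.eval 0 := by
  simpa using res_X_sub_C 0 h

/-- Monicity preserves the degree of `Q` under reduction; `h` may drop in degree, but both
resultants are taken at its original formal degree. -/
lemma res_modEq_of_map_eq {p : ℕ} [Fact p.Prime] {Q Q' : ℤ[X]} (hQ : Q.Monic) (hQ' : Q'.Monic)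
    (e : Q.map (Int.castRingHom (ZMod p)) = Q'.map (Int.castRingHom (ZMod p))) (h : ℤ[X]) :
    (p : ℤ) ∣ res Q h - res Q' h := by
  have hd : Q.natDegree = Q'.natDegree := by
    rw [← hQ.natDegree_map (Int.castRingHom (ZMod p)), e, hQ'.natDegree_map]
  rw [← ZMod.intCast_zmod_eq_zero_iff_dvd, Int.cast_sub, sub_eq_zero]
  change Int.castRingHom (ZMod p) _ = Int.castRingHom (ZMod p) _
  unfold res
  rw [← resultant_map_map, ← resultant_map_map, e, hd]

/-- An integer matrix whose reduction modulo `p` kills two independent vectors has determinant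
divisible by `p ^ 2`. -/
lemma Matrix.sq_dvd_det_of_mulVec_eq_zero {ι : Type*} [Fintype ι] [DecidableEq ι] {p : ℕ}
    [Fact p.Prime] (M : Matrix ι ι ℤ) (w : Fin 2 → ι → ZMod p)
    (hw : LinearIndependent (ZMod p) w)
    (hM : ∀ i, (M.map (Int.castRingHom (ZMod p))).mulVec (w i) = 0) : (p : ℤ) ^ 2 ∣ M.det := by
  classical
  let b := Module.Basis.sumExtend hw
  let e := b.indexEquiv (Pi.basisFun (ZMod p) ι)
  have hb : ∀ i, b (Sum.inl i) = w i := fun i => by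
    simp only [b, Module.Basis.sumExtend, Module.Basis.reindex_apply, Module.Basis.extend_apply_self]
    rfl
  let b' := b.reindex e
  let U : Matrix ι ι (ZMod p) := (Pi.basisFun (ZMod p) ι).toMatrix b'
  have hU : IsUnit U.det := by
    have := Module.Basis.invertibleToMatrix (Pi.basisFun (ZMod p) ι) b'
    exact Matrix.isUnit_det_of_invertible U
  -- Lift the change of basis `U` entrywise to an integer matrix `V`. Its determinant is prime to
  -- `p`, and two columns of `M * V` vanish modulo `p`.
  choose L hL using (ZMod.intCast_surjective (n := p))
  let V : Matrix ι ι ℤ := U.map L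
  have hV : V.map (Int.castRingHom (ZMod p)) = U := by ext i j; simp [V, hL]
  have hVdet : ¬ (p : ℤ) ∣ V.det := by
    rw [← ZMod.intCast_zmod_eq_zero_iff_dvd]
    have : ((V.det : ℤ) : ZMod p) = U.det := by
      rw [← hV]; exact (Int.castRingHom (ZMod p)).map_det V
    rw [this]; exact hU.ne_zero
  have hcol : ∀ i k, (p : ℤ) ∣ (M * V) k (e (Sum.inl i)) := by
    intro i k
    rw [← ZMod.intCast_zmod_eq_zero_iff_dvd]
    have h1 : ((M * V).map (Int.castRingHom (ZMod p))) k (e (Sum.inl i)) = 0 := by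
      rw [Matrix.map_mul, hV]
      have : U.col (e (Sum.inl i)) = w i := by
        ext l; simp [U, b', Module.Basis.toMatrix_apply, hb]
      have h2 := congrFun (hM i) k
      rw [← this] at h2
      exact h2
    exact h1
  have hdet : (p : ℤ) ^ 2 ∣ (M * V).det := by
    rw [Matrix.det_apply]
    refine Finset.dvd_sum fun σ _ => ?_
    refine Dvd.dvd.trans ?_ (Dvd.intro_left _ (Units.smul_def (Equiv.Perm.sign σ) _).symm)
    have hne : e (Sum.inl 1) ∈ Finset.univ.erase (e (Sum.inl 0)) := by simp
    rw [← Finset.mul_prod_erase _ _ (Finset.mem_univ (e (Sum.inl 0))),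
      ← Finset.mul_prod_erase _ _ hne, sq, ← mul_assoc]
    exact Dvd.dvd.mul_right (mul_dvd_mul (hcol 0 _) (hcol 1 _)) _
  rw [Matrix.det_mul] at hdet
  have hc : IsCoprime ((p : ℤ) ^ 2) V.det :=
    ((Nat.prime_iff_prime_int.mp (Fact.out : p.Prime)).irreducible.coprime_iff_not_dvd.mpr
      hVdet).pow_left
  exact hc.dvd_of_dvd_mul_right hdet

/-- If a monic integer polynomial has no root modulo `p`, then `p ∣ Res(Q, h)` implies
`p ^ 2 ∣ Res(Q, h)`. -/
lemma sq_dvd_res_of_no_root {p : ℕ} [Fact p.Prime] {Q : ℤ[X]} (hQ : Q.Monic)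
    (hroot : ∀ a, ¬ (Q.map (Int.castRingHom (ZMod p))).IsRoot a) {h : ℤ[X]}
    (hdvd : (p : ℤ) ∣ res Q h) : (p : ℤ) ^ 2 ∣ res Q h := by
  classical
  set φ := Int.castRingHom (ZMod p)
  set q := Q.map φ
  set g := h.map φ
  have hq : q.Monic := hQ.map φ
  have hqd : q.natDegree = Q.natDegree := hQ.natDegree_map φ
  have hgd : g.natDegree ≤ h.natDegree := natDegree_map_le
  have hres : q.resultant g Q.natDegree h.natDegree = 0 := by
    rw [resultant_map_map]
    exact (ZMod.intCast_zmod_eq_zero_iff_dvd _ _).mpr hdvd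
  have hcop : ¬ IsCoprime q g := by
    rw [← isUnit_resultant_iff_isCoprime hq]
    have := resultant_add_right_deg q g q.natDegree g.natDegree (h.natDegree - g.natDegree) le_rfl
    rw [Nat.add_sub_cancel' hgd, hqd, hres, ← hqd, hq.coeff_natDegree, one_pow, one_mul] at this
    rw [← this]; simp
  set d := EuclideanDomain.gcd q g
  obtain ⟨a, ha⟩ : d ∣ q := EuclideanDomain.gcd_dvd_left _ _
  obtain ⟨c, hc⟩ : d ∣ g := EuclideanDomain.gcd_dvd_right _ _
  have hd0 : d ≠ 0 := fun h0 => hq.ne_zero (by rw [ha, h0, zero_mul])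
  have ha0 : a ≠ 0 := fun h0 => hq.ne_zero (by rw [ha, h0, mul_zero])
  -- A nontrivial gcd of degree 1 would give a root of `q`.
  have hd2 : 2 ≤ d.natDegree := by
    by_contra! hlt
    have hnu : ¬ IsUnit d := by rwa [EuclideanDomain.gcd_isUnit_iff]
    have h1 : d.degree = 1 := by
      have : d.natDegree ≠ 0 := fun h0 => hnu (by
        rw [isUnit_iff_degree_eq_zero, degree_eq_natDegree hd0, h0]; rfl)
      rw [degree_eq_natDegree hd0, show d.natDegree = 1 by lia]; rfl
    obtain ⟨x, hx⟩ := exists_root_of_degree_eq_one h1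
    exact hroot x (by rw [ha]; exact root_mul_right_of_isRoot a hx)
  have hda : d.natDegree + a.natDegree = Q.natDegree := by rw [← natDegree_mul hd0 ha0, ← ha, hqd]
  have hmA : ∀ i : Fin 2, a * X ^ (i : ℕ) ∈ degreeLT (ZMod p) Q.natDegree := fun i => by
    rw [mem_degreeLT, degree_eq_natDegree (mul_ne_zero ha0 (pow_ne_zero _ X_ne_zero)),
      natDegree_mul_X_pow _ ha0, Nat.cast_lt]
    lia
  have hmC : ∀ i : Fin 2, -(c * X ^ (i : ℕ)) ∈ degreeLT (ZMod p) h.natDegree := fun i => by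
    rcases eq_or_ne c 0 with rfl | hc0
    · simp
    have : d.natDegree + c.natDegree ≤ h.natDegree := by rwa [← natDegree_mul hd0 hc0, ← hc]
    rw [Submodule.neg_mem_iff, mem_degreeLT,
      degree_eq_natDegree (mul_ne_zero hc0 (pow_ne_zero _ X_ne_zero)),
      natDegree_mul_X_pow _ hc0, Nat.cast_lt]
    lia
  let b₁ := ((degreeLT.basis (ZMod p) Q.natDegree).prod
    (degreeLT.basis (ZMod p) h.natDegree)).reindex finSumFinEquiv
  let b₂ := degreeLT.basis (ZMod p) (Q.natDegree + h.natDegree)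
  -- With `q = d a` and `g = d c`, the pairs `(a, -c)` and `(aX, -cX)` lie in the kernel of the
  -- Sylvester map; they fit the degree bounds because `deg d ≥ 2`.
  let v : Fin 2 → degreeLT (ZMod p) Q.natDegree × degreeLT (ZMod p) h.natDegree :=
    fun i => (⟨_, hmA i⟩, ⟨_, hmC i⟩)
  have hv : LinearIndependent (ZMod p) v := by
    have e : v = ![v 0, v 1] := by funext i; fin_cases i <;> rfl
    rw [e, LinearIndependent.pair_iff' (fun h0 => ha0 (by
      simpa [v] using congrArg (fun y => (y.1 : (ZMod p)[X])) h0))]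
    intro x hx
    have h1 := congrArg (fun y => (y.1 : (ZMod p)[X])) hx
    simp only [v, Prod.smul_mk, SetLike.mk_smul_mk, Fin.val_zero, Fin.val_one, pow_zero, pow_one,
      mul_one] at h1
    have h2 := congrArg natDegree h1
    rw [natDegree_mul_X ha0] at h2
    have := natDegree_smul_le x a
    lia
  refine Matrix.sq_dvd_det_of_mulVec_eq_zero (p := p) (sylvester Q h Q.natDegree h.natDegree)
    (fun i => b₁.equivFun (v i)) ?_ fun i => ?_
  · exact hv.map' b₁.equivFun.toLinearMap (LinearMap.ker_eq_bot.mpr b₁.equivFun.injective)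
  · have hs := sylvester_map_map Q h Q.natDegree h.natDegree φ
    rw [RingHom.mapMatrix_apply] at hs
    rw [← hs, ← toMatrix_sylvesterMap' q g hqd.le hgd]
    have h3 := LinearMap.toMatrix_mulVec_repr b₁ b₂ (sylvesterMap q g hqd.le hgd) (v i)
    have h4 : sylvesterMap q g hqd.le hgd (v i) = 0 := by
      ext1
      rw [sylvesterMap_apply_coe]
      simp only [v, ha, hc, ZeroMemClass.coe_zero]
      ring
    rw [h4] at h3
    simpa using h3

/-! ### Chebyshev identities in the variable `z + z⁻¹`. -/

lemma sub_inv_mul_aeval_S {z : ℂ} (hz : z ≠ 0) (n : ℕ) :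
    (z - z⁻¹) * aeval (z + z⁻¹) (Chebyshev.S ℤ (n - 1)) = z ^ n - z⁻¹ ^ n := by
  induction n using Nat.twoStepInduction with
  | zero => simp
  | one => simp
  | more n ih₁ ih₂ =>
    have h := Chebyshev.S_add_two ℤ ((n : ℤ) - 1)
    rw [show ((n : ℤ) - 1 + 2) = ((n + 2 : ℕ) : ℤ) - 1 by push_cast; ring,
      show ((n : ℤ) - 1 + 1) = ((n + 1 : ℕ) : ℤ) - 1 by push_cast; ring] at h
    rw [h, map_sub, map_mul, aeval_X, mul_sub, ih₁, mul_left_comm, ih₂]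
    linear_combination (z ^ n - z⁻¹ ^ n) * mul_inv_cancel₀ hz

lemma aeval_add_inv_C {z : ℂ} (hz : z ≠ 0) (n : ℕ) :
    aeval (z + z⁻¹) (Chebyshev.C ℤ n) = z ^ n + z⁻¹ ^ n := by
  induction n using Nat.twoStepInduction with
  | zero => rw [Nat.cast_zero, Chebyshev.C_zero, map_ofNat]; norm_num
  | one => simp
  | more n ih₁ ih₂ =>
    have h := Chebyshev.C_add_two ℤ (n : ℤ)
    push_cast at ih₂ ⊢
    rw [h, map_sub, map_mul, aeval_X, ih₁, ih₂]
    linear_combination (z ^ n + z⁻¹ ^ n) * mul_inv_cancel₀ hz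

/-- Integer polynomials agreeing at all `z + z⁻¹` with `z ≠ 0, ±1` are equal. -/
lemma eq_of_aeval_add_inv_eq {P Q : ℤ[X]}
    (H : ∀ z : ℂ, z ≠ 0 → z - z⁻¹ ≠ 0 → aeval (z + z⁻¹) P = aeval (z + z⁻¹) Q) : P = Q := by
  apply map_injective (Int.castRingHom ℂ) Int.cast_injective
  refine eq_of_infinite_eval_eq _ _ (Set.Infinite.mono ?_
    (Set.toFinite {(2 : ℂ), -2}).infinite_compl)
  intro x hx
  simp only [Set.mem_compl_iff, Set.mem_insert_iff, Set.mem_singleton_iff, not_or] at hx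
  -- Solve `z + z⁻¹ = x` by `z = (x + s)/2`; then `z - z⁻¹ = s`, nonzero since `x ≠ ±2`.
  obtain ⟨s, hs⟩ := IsAlgClosed.exists_pow_nat_eq (x ^ 2 - 4) (n := 2) (by norm_num)
  have hmul : ((x + s) / 2) * ((x - s) / 2) = 1 := by linear_combination (-1 / 4 : ℂ) * hs
  have hinv : ((x + s) / 2)⁻¹ = (x - s) / 2 := inv_eq_of_mul_eq_one_right hmul
  have hs0 : s ≠ 0 := by
    rintro rfl
    have : (x - 2) * (x + 2) = 0 := by linear_combination -hs
    rcases mul_eq_zero.mp this with h | h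
    · exact hx.1 (sub_eq_zero.mp h)
    · exact hx.2 (eq_neg_of_add_eq_zero_left h)
  have := H ((x + s) / 2) (left_ne_zero_of_mul_eq_one hmul) (by
    rw [hinv]; ring_nf; exact hs0)
  rw [hinv, show (x + s) / 2 + (x - s) / 2 = x by ring] at this
  simpa [aeval_def, eval_map] using this

lemma S_monic_natDegree (n : ℕ) :
    (Chebyshev.S ℤ n).Monic ∧ (Chebyshev.S ℤ n).natDegree = n := by
  induction n using Nat.twoStepInduction with
  | zero => simp
  | one => simp [monic_X]
  | more n ih₁ ih₂ =>
    have h := Chebyshev.S_add_two ℤ (n : ℤ)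
    push_cast at ih₂ ⊢
    have hd : (X * Chebyshev.S ℤ (n + 1)).natDegree = n + 2 := by
      rw [natDegree_X_mul ih₂.1.ne_zero, ih₂.2]
    have hlt : (Chebyshev.S ℤ n).natDegree < (X * Chebyshev.S ℤ (n + 1)).natDegree := by
      rw [hd, ih₁.2]; lia
    rw [h]
    exact ⟨(monic_X.mul ih₂.1).sub_of_left (degree_lt_degree hlt),
      by rw [natDegree_sub_eq_left_of_natDegree_lt hlt, hd]⟩

lemma S_sub_one_monic {n : ℕ} (hn : 0 < n) : (Chebyshev.S ℤ (n - 1)).Monic := by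
  have := (S_monic_natDegree (n - 1)).1
  rwa [Nat.cast_pred hn] at this

lemma natDegree_S_sub_one {n : ℕ} (hn : 0 < n) : (Chebyshev.S ℤ (n - 1)).natDegree = n - 1 := by
  have := (S_monic_natDegree (n - 1)).2
  rwa [Nat.cast_pred hn] at this

lemma C_monic_natDegree (n : ℕ) :
    (Chebyshev.C ℤ (n + 1)).Monic ∧ (Chebyshev.C ℤ (n + 1)).natDegree = n + 1 := by
  induction n using Nat.twoStepInduction with
  | zero => simp [monic_X]
  | one =>
    rw [show ((1 : ℕ) : ℤ) + 1 = 2 by rfl, Chebyshev.C_two]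
    exact ⟨by monicity!, by compute_degree!⟩
  | more n ih₁ ih₂ =>
    have h := Chebyshev.C_add_two ℤ ((n : ℤ) + 1)
    push_cast at ih₂ ⊢
    rw [show (n : ℤ) + 1 + 2 = n + 2 + 1 by ring] at h
    have hd : (X * Chebyshev.C ℤ (n + 1 + 1)).natDegree = n + 2 + 1 := by
      rw [natDegree_X_mul ih₂.1.ne_zero, ih₂.2]
    have hlt : (Chebyshev.C ℤ (n + 1)).natDegree < (X * Chebyshev.C ℤ (n + 1 + 1)).natDegree := by
      rw [hd, ih₁.2]; lia
    rw [h]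
    exact ⟨(monic_X.mul ih₂.1).sub_of_left (degree_lt_degree hlt),
      by rw [natDegree_sub_eq_left_of_natDegree_lt hlt, hd]⟩

lemma C_monic {n : ℕ} (hn : 0 < n) : (Chebyshev.C ℤ n).Monic := by
  obtain ⟨m, rfl⟩ := Nat.exists_eq_add_of_lt hn
  simpa using (C_monic_natDegree m).1

lemma natDegree_C_eq {n : ℕ} (hn : 0 < n) : (Chebyshev.C ℤ n).natDegree = n := by
  obtain ⟨m, rfl⟩ := Nat.exists_eq_add_of_lt hn
  simpa using (C_monic_natDegree m).2

lemma S_mul_sub_one (m n : ℕ) : Chebyshev.S ℤ ((m * n : ℕ) - 1) =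
    Chebyshev.S ℤ (n - 1) * (Chebyshev.S ℤ (m - 1)).comp (Chebyshev.C ℤ n) := by
  rcases Nat.eq_zero_or_pos n with rfl | hn
  · simp
  refine mul_left_cancel₀ (a := X ^ 2 - 4)
    (by intro h; simpa using congrArg (eval 0) h) ?_
  refine mul_left_cancel₀ (S_sub_one_monic hn).ne_zero (eq_of_aeval_add_inv_eq fun z hz hz' => ?_)
  have h₁ := sub_inv_mul_aeval_S hz (m * n)
  have h₂ := sub_inv_mul_aeval_S hz n
  have h₃ := sub_inv_mul_aeval_S (pow_ne_zero n hz) m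
  have h₄ := aeval_add_inv_C hz n
  simp only [map_mul, map_sub, map_pow, aeval_X, aeval_comp, h₄, map_ofNat]
  rw [← inv_pow, ← pow_mul, ← pow_mul, mul_comm n m] at h₃
  generalize aeval (z + z⁻¹) (Chebyshev.S ℤ (n - 1)) = a at *
  generalize aeval (z + z⁻¹) (Chebyshev.S ℤ ((m * n : ℕ) - 1)) = b at *
  generalize aeval (z ^ n + z⁻¹ ^ n) (Chebyshev.S ℤ (m - 1)) = c at *
  have h₅ : (z + z⁻¹) ^ 2 - 4 = (z - z⁻¹) ^ 2 := by
    linear_combination 4 * mul_inv_cancel₀ hz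
  rw [h₅]
  linear_combination (z - z⁻¹) * a * (h₁ - h₃) + c * (z - z⁻¹) * a * (- h₂)

lemma C_sq_sub_four (n : ℕ) :
    Chebyshev.C ℤ n ^ 2 - 4 = (X ^ 2 - 4) * Chebyshev.S ℤ (n - 1) ^ 2 := by
  refine eq_of_aeval_add_inv_eq fun z hz hz' => ?_
  have h₁ := sub_inv_mul_aeval_S hz n
  have hp : z ^ n * z⁻¹ ^ n = 1 := by rw [← mul_pow, mul_inv_cancel₀ hz, one_pow]
  simp only [map_mul, map_sub, map_pow, aeval_X, aeval_add_inv_C hz, map_ofNat]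
  generalize aeval (z + z⁻¹) (Chebyshev.S ℤ (n - 1)) = a at *
  have h₅ : (z + z⁻¹) ^ 2 - 4 = (z - z⁻¹) ^ 2 := by
    linear_combination 4 * mul_inv_cancel₀ hz
  rw [h₅, ← mul_pow, h₁]
  linear_combination 4 * hp

lemma S_two_mul_sub_one (n : ℕ) : Chebyshev.S ℤ ((2 * n : ℕ) - 1) =
    Chebyshev.S ℤ (n - 1) * Chebyshev.C ℤ n := by
  rw [S_mul_sub_one]; norm_num

lemma C_two_mul (n : ℕ) : Chebyshev.C ℤ (2 * n : ℕ) = Chebyshev.C ℤ n ^ 2 - 2 := by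
  push_cast
  rw [Chebyshev.C_mul, Chebyshev.C_two]; simp

/-- `x^{-k} (x^{2k+1} - 1)/(x - 1)` as a polynomial in `x + x⁻¹`. -/
noncomputable def oddMinus (k : ℕ) : ℤ[X] := Chebyshev.S ℤ k + Chebyshev.S ℤ (k - 1)

/-- `x^{-k} (x^{2k+1} + 1)/(x + 1)` as a polynomial in `x + x⁻¹`. -/
noncomputable def oddPlus (k : ℕ) : ℤ[X] := Chebyshev.S ℤ k - Chebyshev.S ℤ (k - 1)

lemma degree_S_sub_one_lt (k : ℕ) :
    (Chebyshev.S ℤ (k - 1)).degree < (Chebyshev.S ℤ k).degree := by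
  rcases Nat.eq_zero_or_pos k with rfl | hk
  · simp
  · apply degree_lt_degree
    rw [natDegree_S_sub_one hk, (S_monic_natDegree k).2]; lia

lemma oddMinus_monic (k : ℕ) : (oddMinus k).Monic :=
  (S_monic_natDegree k).1.add_of_left (degree_S_sub_one_lt k)

lemma oddPlus_monic (k : ℕ) : (oddPlus k).Monic :=
  (S_monic_natDegree k).1.sub_of_left (degree_S_sub_one_lt k)

lemma S_two_mul (k : ℕ) : Chebyshev.S ℤ ((2 * k + 1 : ℕ) - 1) = oddMinus k * oddPlus k := by
  refine eq_of_aeval_add_inv_eq fun z hz hz' => ?_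
  have h₁ := sub_inv_mul_aeval_S hz (2 * k + 1)
  have h₂ := sub_inv_mul_aeval_S hz k
  have h₃ := sub_inv_mul_aeval_S hz (k + 1)
  rw [show ((k + 1 : ℕ) : ℤ) - 1 = k by push_cast; ring] at h₃
  have hp : z ^ k * z⁻¹ ^ k = 1 := by rw [← mul_pow, mul_inv_cancel₀ hz, one_pow]
  have hz1 := mul_inv_cancel₀ hz
  simp only [oddMinus, oddPlus, map_mul, map_sub, map_add]
  generalize aeval (z + z⁻¹) (Chebyshev.S ℤ (k - 1)) = a at *
  generalize aeval (z + z⁻¹) (Chebyshev.S ℤ k) = b at *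
  generalize aeval (z + z⁻¹) (Chebyshev.S ℤ ((2 * k + 1 : ℕ) - 1)) = c at *
  refine mul_left_cancel₀ (pow_ne_zero 2 hz') ?_
  have e : (z - z⁻¹) ^ 2 * ((b + a) * (b - a)) = ((z - z⁻¹) * b) ^ 2 - ((z - z⁻¹) * a) ^ 2 := by
    ring
  have e₁ : ∀ x : ℂ, x ^ (2 * k + 1) = (x ^ k) ^ 2 * x := fun x => by ring
  rw [e, h₂, h₃, sq, mul_assoc, h₁, e₁, e₁, pow_succ _ k, pow_succ _ k]
  generalize z⁻¹ = w at *
  generalize z ^ k = A at *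
  generalize w ^ k = B at *
  linear_combination (-A ^ 2 - B ^ 2 + 2 * A * B) * hz1

lemma C_two_mul_add_one (k : ℕ) :
    Chebyshev.C ℤ (2 * k + 1 : ℕ) = (X - 2) * oddMinus k ^ 2 + 2 := by
  refine eq_of_aeval_add_inv_eq fun z hz hz' => ?_
  have h₂ := sub_inv_mul_aeval_S hz k
  have h₃ := sub_inv_mul_aeval_S hz (k + 1)
  rw [show ((k + 1 : ℕ) : ℤ) - 1 = k by push_cast; ring] at h₃
  have hp : z ^ k * z⁻¹ ^ k = 1 := by rw [← mul_pow, mul_inv_cancel₀ hz, one_pow]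
  have hz1 := mul_inv_cancel₀ hz
  simp only [oddMinus, map_mul, map_sub, map_add, map_pow, map_ofNat, aeval_X, aeval_add_inv_C hz]
  generalize aeval (z + z⁻¹) (Chebyshev.S ℤ (k - 1)) = a at *
  generalize aeval (z + z⁻¹) (Chebyshev.S ℤ k) = b at *
  refine mul_left_cancel₀ (pow_ne_zero 2 hz') ?_
  have e : (z - z⁻¹) ^ 2 * ((z + z⁻¹ - 2) * (b + a) ^ 2 + 2) =
    (z + z⁻¹ - 2) * ((z - z⁻¹) * b + (z - z⁻¹) * a) ^ 2 + 2 * (z - z⁻¹) ^ 2 := by ring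
  have e₁ : ∀ x : ℂ, x ^ (2 * k + 1) = (x ^ k) ^ 2 * x := fun x => by ring
  rw [e, h₂, h₃, e₁, e₁, pow_succ _ k, pow_succ _ k]
  generalize z⁻¹ = w at *
  generalize z ^ k = A at *
  generalize w ^ k = B at *
  obtain rfl : w = z⁻¹ := eq_inv_of_mul_eq_one_right hz1
  obtain rfl : B = A⁻¹ := eq_inv_of_mul_eq_one_right hp
  have hA : A ≠ 0 := left_ne_zero_of_mul_eq_one hp
  field_simp
  ring

lemma X_dvd_C_odd (k : ℕ) : X ∣ Chebyshev.C ℤ (2 * k + 1 : ℕ) := by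
  rw [X_dvd_iff, coeff_zero_eq_eval_zero]
  induction k with
  | zero => simp
  | succ k ih =>
    have h := Chebyshev.C_add_two ℤ ((2 * k + 1 : ℕ) : ℤ)
    rw [show ((2 * k + 1 : ℕ) : ℤ) + 2 = (2 * (k + 1) + 1 : ℕ) by push_cast; ring] at h
    rw [h, eval_sub, ih, eval_mul, eval_X, zero_mul, sub_zero]

/-- `C_{3s} = C_s ∘ C_3`, where `C_3 = X(X² - 3)` and `X ∣ C_s` because `s` is odd. -/
lemma X_mul_dvd_C_odd {k : ℕ} (hk : 3 ∣ 2 * k + 1) :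
    X * (X ^ 2 - 3) ∣ Chebyshev.C ℤ (2 * k + 1 : ℕ) := by
  obtain ⟨s, hs⟩ := hk
  obtain ⟨j, hj⟩ : Odd s := by
    by_contra h
    obtain ⟨i, rfl⟩ := Nat.not_odd_iff_even.mp h
    lia
  obtain ⟨E, hE⟩ := X_dvd_C_odd j
  refine ⟨E.comp (X * (X ^ 2 - 3)), ?_⟩
  have h3 : Chebyshev.C ℤ 3 = X * (X ^ 2 - 3) := by
    have := Chebyshev.C_add_two ℤ 1
    norm_num [Chebyshev.C_two] at this
    rw [this]; ring
  rw [hs, mul_comm 3, Nat.cast_mul, Chebyshev.C_mul, hj, hE, Nat.cast_ofNat, h3, mul_comp, X_comp]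

/-- Since `C_p ≡ X^p`, the Pell identity `C_p² - 4 = (X² - 4) S_{p-1}²` becomes `(X² - 4)^p = (X² -
4) S_{p-1}²` modulo `p`. Working with the square covers `p = 2` as well. -/
lemma map_S_sub_one_sq (p : ℕ) [Fact p.Prime] :
    (Chebyshev.S ℤ (p - 1)).map (Int.castRingHom (ZMod p)) ^ 2 = (X ^ 2 - 4) ^ (p - 1) := by
  have hpp : p.Prime := Fact.out
  have h := congrArg (Polynomial.map (Int.castRingHom (ZMod p))) (C_sq_sub_four p)
  have hC : (Chebyshev.C ℤ p).map (Int.castRingHom (ZMod p)) = X ^ p := by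
    rw [Chebyshev.map_C, ← dickson_one_one_eq_chebyshev_C, dickson_one_one_zmod_p]
  have h4 : (X ^ 2 - 4 : (ZMod p)[X]) ≠ 0 := by
    intro h
    have := congrArg (fun q => coeff q 2) h
    simp at this
  simp only [Polynomial.map_sub, Polynomial.map_mul, Polynomial.map_pow, hC, map_X,
    Polynomial.map_ofNat] at h
  refine mul_left_cancel₀ h4 ?_
  rw [← h, mul_pow_sub_one hpp.ne_zero, sub_pow_char, ← pow_mul, ← pow_mul, mul_comm]
  congr 1
  rw [show (4 : (ZMod p)[X]) = Polynomial.C 4 by rfl, ← Polynomial.C_pow, ZMod.pow_card]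

/-- The quotient `S_{pn-1} / S_{n-1}` modulo `p`, squared. -/
lemma map_S_comp_C_sq (p n : ℕ) [Fact p.Prime] :
    ((((Chebyshev.S ℤ (p - 1)).comp (Chebyshev.C ℤ n)) ^ 2).map (Int.castRingHom (ZMod p))) =
      (((X - Polynomial.C 2) * (X - Polynomial.C (-2)) * Chebyshev.S ℤ (n - 1) ^ 2) ^ (p - 1)).map
        (Int.castRingHom (ZMod p)) := by
  have h := congrArg (Polynomial.map (Int.castRingHom (ZMod p))) (C_sq_sub_four n)
  have e : ((X - Polynomial.C 2) * (X - Polynomial.C (-2)) : ℤ[X]) = X ^ 2 - 4 := by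
    rw [Polynomial.C_neg, show (Polynomial.C 2 : ℤ[X]) = 2 by rfl]; ring
  rw [e, ← C_sq_sub_four, Polynomial.map_pow, Polynomial.map_comp, ← pow_comp, map_S_sub_one_sq p]
  simp

/-! ### The measure as a product of outer values and a squared resultant. -/

/-- Modulo `x² = t x - 1`, every polynomial in `x` is of the form `A(t) + B(t) x`. -/
lemma exists_aeval_eq_add_inv (f : ℤ[X]) : ∃ A B : ℤ[X], ∀ z : ℂ, z ≠ 0 →
    aeval z f = aeval (z + z⁻¹) A + aeval (z + z⁻¹) B * z := by
  induction f using Polynomial.induction_on with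
  | C a => exact ⟨C a, 0, fun z _ => by simp⟩
  | add f g hf hg =>
    obtain ⟨A, B, h⟩ := hf
    obtain ⟨A', B', h'⟩ := hg
    exact ⟨A + A', B + B', fun z hz => by simp only [map_add, h z hz, h' z hz]; ring⟩
  | monomial n a ih =>
    obtain ⟨A, B, h⟩ := ih
    refine ⟨-B, A + X * B, fun z hz => ?_⟩
    rw [pow_succ, ← mul_assoc, map_mul, h z hz]
    simp only [map_add, map_neg, map_mul, aeval_X]
    linear_combination (-aeval (z + z⁻¹) B) * mul_inv_cancel₀ hz

lemma aeval_intCast_eq (f : ℤ[X]) (c : ℤ) : aeval (c : ℂ) f = ((f.eval c : ℤ) : ℂ) :=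
  aeval_algebraMap_apply_eq_algebraMap_eval c f

lemma IsPrimitiveRoot.pow_half_eq_neg_one {n : ℕ} (hn : 0 < n) {ζ : ℂ}
    (hζ : IsPrimitiveRoot ζ (2 * n)) : ζ ^ n = -1 := by
  have h2 : (ζ ^ n) ^ 2 = 1 := by rw [← pow_mul, mul_comm, hζ.pow_eq_one]
  rcases sq_eq_one_iff.mp h2 with h | h
  · exact absurd h (hζ.pow_ne_one_of_pos_of_lt (by lia) (by lia))
  · exact h

/-- A product over the `2n`-th roots of unity of a function invariant under inversion. -/
lemma prod_pow_two_mul {n : ℕ} (hn : 0 < n) {ζ : ℂ} (hζ : IsPrimitiveRoot ζ (2 * n))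
    (φ : ℂ → ℂ) (hφ : ∀ z, z ^ (2 * n) = 1 → φ z⁻¹ = φ z) :
    ∏ j ∈ Finset.range (2 * n), φ (ζ ^ j) =
      φ 1 * φ (-1) * (∏ j ∈ Finset.range (n - 1), φ (ζ ^ (j + 1))) ^ 2 := by
  have hhalf := hζ.pow_half_eq_neg_one hn
  obtain ⟨m, rfl⟩ := Nat.exists_eq_add_of_lt hn
  rw [zero_add] at *
  -- After reflecting the index, `ζ^{n+i}` is paired with its inverse `ζ^{n-i}`, so the lower half
  -- repeats the upper half.
  have h : ∏ j ∈ Finset.range m, φ (ζ ^ (m + 1 + (j + 1))) =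
      ∏ j ∈ Finset.range m, φ (ζ ^ (j + 1)) := by
    rw [← Finset.prod_range_reflect]
    refine Finset.prod_congr rfl fun j hj => ?_
    rw [Finset.mem_range] at hj
    rw [← hφ (ζ ^ (j + 1)) (by rw [← pow_mul, mul_comm, pow_mul, hζ.pow_eq_one, one_pow])]
    congr 1
    apply eq_inv_of_mul_eq_one_left
    rw [← pow_add, ← hζ.pow_eq_one]
    congr 1; lia
  rw [two_mul, Finset.prod_range_add, Finset.prod_range_succ', Finset.prod_range_succ' _ m, h,
    Nat.add_sub_cancel, pow_zero, add_zero, hhalf]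
  ring

/-- The roots of `S_{n-1}` are the `ζ^j + ζ^{-j}`, `0 < j < n`. -/
lemma map_S_sub_one_eq_prod {n : ℕ} (hn : 0 < n) {ζ : ℂ} (hζ : IsPrimitiveRoot ζ (2 * n)) :
    (Chebyshev.S ℤ (n - 1)).map (Int.castRingHom ℂ) =
      ∏ j ∈ Finset.range (n - 1), (X - C (ζ ^ (j + 1) + (ζ ^ (j + 1))⁻¹)) := by
  have hζ0 : ζ ≠ 0 := hζ.ne_zero (by lia)
  have hmon := (S_sub_one_monic hn).map (Int.castRingHom ℂ)
  have hdeg : ((Chebyshev.S ℤ (n - 1)).map (Int.castRingHom ℂ)).natDegree = n - 1 := by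
    rw [(S_sub_one_monic hn).natDegree_map, natDegree_S_sub_one hn]
  have hne : ∀ i j, 0 < i → i < n → 0 < j → j < n → ζ ^ i * ζ ^ j ≠ 1 := by
    intro i j hi hi' hj hj' h
    rw [← pow_add] at h
    exact hζ.pow_ne_one_of_pos_of_lt (by lia) (by lia) h
  -- `a + a⁻¹ = b + b⁻¹` means `(a - b)(ab - 1) = 0`, and `ab = 1` is excluded because the exponents
  -- sum to less than `2n`.
  have hinj : Set.InjOn (fun j => ζ ^ (j + 1) + (ζ ^ (j + 1))⁻¹) (Finset.range (n - 1)) := by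
    intro i hi j hj hij
    simp only [Finset.coe_range, Set.mem_Iio] at hi hj
    have h1 := hne (i + 1) (j + 1) (by lia) (by lia) (by lia) (by lia)
    have hi0 := pow_ne_zero (i + 1) hζ0
    have hj0 := pow_ne_zero (j + 1) hζ0
    have h2 : (ζ ^ (i + 1) - ζ ^ (j + 1)) * (ζ ^ (i + 1) * ζ ^ (j + 1) - 1) = 0 := by
      simp only at hij
      generalize ζ ^ (i + 1) = a at *
      generalize ζ ^ (j + 1) = b at *
      field_simp at hij
      linear_combination hij
    have h3 := (mul_eq_zero.mp h2).resolve_right (sub_ne_zero.mpr h1)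
    have := hζ.pow_inj (by lia) (by lia) (sub_eq_zero.mp h3)
    lia
  have hroot : ∀ j ∈ Finset.range (n - 1),
      ((Chebyshev.S ℤ (n - 1)).map (Int.castRingHom ℂ)).IsRoot (ζ ^ (j + 1) + (ζ ^ (j + 1))⁻¹) := by
    intro j hj
    rw [Finset.mem_range] at hj
    have hz := pow_ne_zero (j + 1) hζ0
    have h := sub_inv_mul_aeval_S hz n
    have h1 := hne (j + 1) (j + 1) (by lia) (by lia) (by lia) (by lia)
    have h2 : ((ζ ^ (j + 1)) ^ n) * ((ζ ^ (j + 1)) ^ n) = 1 := by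
      rw [← pow_add, ← two_mul, ← pow_mul, mul_comm, pow_mul, hζ.pow_eq_one, one_pow]
    rw [inv_pow, inv_eq_of_mul_eq_one_right h2, sub_self, mul_eq_zero] at h
    rw [IsRoot, eval_map, ← algebraMap_int_eq, ← aeval_def]
    refine h.resolve_left fun h0 => h1 ?_
    nth_rewrite 2 [sub_eq_zero.mp h0]
    exact mul_inv_cancel₀ hz
  set s := (Finset.range (n - 1)).image (fun j => ζ ^ (j + 1) + (ζ ^ (j + 1))⁻¹) with hs
  have hcard : s.card = n - 1 := by rw [hs, Finset.card_image_of_injOn hinj, Finset.card_range]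
  have hsub : s.val ≤ ((Chebyshev.S ℤ (n - 1)).map (Int.castRingHom ℂ)).roots := by
    rw [Multiset.le_iff_subset s.nodup]
    intro x hx
    obtain ⟨j, hj, rfl⟩ := Finset.mem_image.mp (Finset.mem_val.mp hx)
    exact (mem_roots hmon.ne_zero).mpr (hroot j hj)
  have heq : s.val = ((Chebyshev.S ℤ (n - 1)).map (Int.castRingHom ℂ)).roots := by
    refine Multiset.eq_of_le_of_card_le hsub ?_
    rw [← hdeg] at hcard
    exact (card_roots' _).trans hcard.ge
  have := prod_multiset_X_sub_C_of_monic_of_roots_card_eq hmon (by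
    rw [← heq, hdeg]; exact hcard)
  rw [← this, ← heq]
  exact Finset.prod_image hinj

lemma res_S_sub_one {n : ℕ} (hn : 0 < n) {ζ : ℂ} (hζ : IsPrimitiveRoot ζ (2 * n)) (h : ℤ[X]) :
    ((res (Chebyshev.S ℤ (n - 1)) h : ℤ) : ℂ) =
      ∏ j ∈ Finset.range (n - 1), aeval (ζ ^ (j + 1) + (ζ ^ (j + 1))⁻¹) h := by
  change Int.castRingHom ℂ _ = _
  unfold res
  rw [← resultant_map_map, ← (S_sub_one_monic hn).natDegree_map (Int.castRingHom ℂ),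
    map_S_sub_one_eq_prod hn hζ, resultant_prod_left _ _ _ _ (by simp [-map_add]) natDegree_map_le]
  refine Finset.prod_congr rfl fun j _ => ?_
  rw [natDegree_X_sub_C, resultant_X_sub_C_left _ _ _ natDegree_map_le, eval_map,
    ← algebraMap_int_eq, ← aeval_def]

/-- The norm `f(x) f(x⁻¹)` of `A(t) + B(t) x`, as a polynomial in `t = x + x⁻¹`. -/
noncomputable def normPoly (A B : ℤ[X]) : ℤ[X] := A ^ 2 + A * B * X + B ^ 2

/-- `f(x) f(x⁻¹) - x^n g(x) g(x⁻¹)` at the `2n`-th roots of unity `x ≠ ±1`, as a polynomial in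
`x + x⁻¹`. -/
noncomputable def measurePoly (n : ℕ) (A B A' B' : ℤ[X]) : ℤ[X] :=
  normPoly A B + Chebyshev.S ℤ (n - 2) * normPoly A' B'

/-- As `z⁻ⁿ = zⁿ`, the numerator `z^{n-1} - z^{-(n-1)}` of `S_{n-2}` equals `-zⁿ(z - z⁻¹)`. This
replaces `zⁿ` by a polynomial in `z + z⁻¹`, but only for `z ≠ ±1`. -/
lemma pow_mul_sub_inv_eq {n : ℕ} (hn : 0 < n) {z : ℂ} (hz : z ^ (2 * n) = 1)
    (h1 : z - z⁻¹ ≠ 0) : z ^ n = -aeval (z + z⁻¹) (Chebyshev.S ℤ (n - 2)) := by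
  have hz0 : z ≠ 0 := by rintro rfl; simp [hn.ne'] at hz
  have h := sub_inv_mul_aeval_S hz0 (n - 1)
  rw [Nat.cast_pred hn, show ((n : ℤ) - 1 - 1) = n - 2 by ring] at h
  refine mul_left_cancel₀ h1 ?_
  rw [mul_neg, h]
  obtain ⟨m, rfl⟩ := Nat.exists_eq_add_of_lt hn
  rw [zero_add] at *
  rw [Nat.add_sub_cancel]
  have h2 : z⁻¹ ^ m = z ^ (m + 2) := by
    rw [inv_pow]
    apply inv_eq_of_mul_eq_one_right
    rw [← pow_add, ← hz]; congr 1; lia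
  rw [h2]
  linear_combination (-z ^ m) * mul_inv_cancel₀ hz0

theorem dicyclicMeasure_eq {n : ℕ} (hn : 0 < n) (f g : ℤ[X]) : ∃ A B A' B' : ℤ[X],
    f.eval 1 = A.eval 2 + B.eval 2 ∧ f.eval (-1) = A.eval (-2) - B.eval (-2) ∧
    g.eval 1 = A'.eval 2 + B'.eval 2 ∧ g.eval (-1) = A'.eval (-2) - B'.eval (-2) ∧
    dicyclicMeasure n f g =
      (((f.eval 1 ^ 2 - g.eval 1 ^ 2) * (f.eval (-1) ^ 2 - (-1) ^ n * g.eval (-1) ^ 2) *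
        res (Chebyshev.S ℤ (n - 1)) (measurePoly n A B A' B') ^ 2 : ℤ) : ℂ) := by
  obtain ⟨A, B, hAB⟩ := exists_aeval_eq_add_inv f
  obtain ⟨A', B', hAB'⟩ := exists_aeval_eq_add_inv g
  have key1 : ∀ {q a b : ℤ[X]}, (∀ z : ℂ, z ≠ 0 →
      aeval z q = aeval (z + z⁻¹) a + aeval (z + z⁻¹) b * z) →
      q.eval 1 = a.eval 2 + b.eval 2 ∧ q.eval (-1) = a.eval (-2) - b.eval (-2) := by
    intro q a b h
    constructor
    · have := h ((1 : ℤ) : ℂ) (by simp)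
      rw [show (((1 : ℤ) : ℂ) + ((1 : ℤ) : ℂ)⁻¹) = ((2 : ℤ) : ℂ) by norm_num, aeval_intCast_eq,
        aeval_intCast_eq, aeval_intCast_eq] at this
      have h' : q.eval 1 = a.eval 2 + b.eval 2 * 1 := by exact_mod_cast this
      rw [h', mul_one]
    · have := h ((-1 : ℤ) : ℂ) (by simp)
      rw [show (((-1 : ℤ) : ℂ) + ((-1 : ℤ) : ℂ)⁻¹) = ((-2 : ℤ) : ℂ) by norm_num, aeval_intCast_eq,
        aeval_intCast_eq, aeval_intCast_eq] at this
      have h' : q.eval (-1) = a.eval (-2) + b.eval (-2) * (-1) := by exact_mod_cast this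
      rw [h']; ring
  have key2 : ∀ {q a b : ℤ[X]}, (∀ z : ℂ, z ≠ 0 →
      aeval z q = aeval (z + z⁻¹) a + aeval (z + z⁻¹) b * z) → ∀ z : ℂ, z ≠ 0 →
      aeval z q * aeval z⁻¹ q = aeval (z + z⁻¹) (normPoly a b) := by
    intro q a b h z hz
    have h2 := h z⁻¹ (inv_ne_zero hz)
    rw [inv_inv, add_comm z⁻¹] at h2
    rw [h z hz, h2, normPoly]
    simp only [map_add, map_mul, map_pow, aeval_X]
    linear_combination (aeval (z + z⁻¹) b) ^ 2 * mul_inv_cancel₀ hz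
  refine ⟨A, B, A', B', (key1 hAB).1, (key1 hAB).2, (key1 hAB').1, (key1 hAB').2, ?_⟩
  have hζ := Complex.isPrimitiveRoot_exp (2 * n) (by lia)
  unfold dicyclicMeasure cyclicMeasure
  generalize Complex.exp (2 * Real.pi * Complex.I / (2 * n : ℕ)) = ζ at hζ ⊢
  rw [prod_pow_two_mul hn hζ (fun z => aeval z f * aeval z⁻¹ f - z ^ n * (aeval z g * aeval z⁻¹ g))]
  · push_cast
    rw [res_S_sub_one hn hζ]
    have e1 : ∀ q : ℤ[X], aeval (1 : ℂ) q = ((q.eval 1 : ℤ) : ℂ) := fun q => by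
      simpa using aeval_intCast_eq q 1
    have e2 : ∀ q : ℤ[X], aeval (-1 : ℂ) q = ((q.eval (-1) : ℤ) : ℂ) := fun q => by
      simpa using aeval_intCast_eq q (-1)
    congr 1
    · simp only [inv_one, inv_neg, e1, e2, one_pow]
      ring
    · congr 1
      refine Finset.prod_congr rfl fun j hj => ?_
      rw [Finset.mem_range] at hj
      set z := ζ ^ (j + 1) with hz
      have hz0 : z ≠ 0 := pow_ne_zero _ (hζ.ne_zero (by lia))
      have hz1 : z - z⁻¹ ≠ 0 := by
        intro h
        have h2 : z * z = 1 := by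
          nth_rewrite 2 [sub_eq_zero.mp h]; exact mul_inv_cancel₀ hz0
        rw [hz, ← pow_add] at h2
        exact hζ.pow_ne_one_of_pos_of_lt (by lia) (by lia) h2
      have hz2 : z ^ (2 * n) = 1 := by
        rw [hz, ← pow_mul, mul_comm (j + 1), pow_mul, hζ.pow_eq_one, one_pow]
      rw [key2 hAB z hz0, key2 hAB' z hz0, pow_mul_sub_inv_eq hn hz2 hz1, measurePoly, map_add,
        map_mul]
      ring
  · intro z hz
    have h2 : z ^ n * z ^ n = 1 := by rw [← pow_add, ← two_mul, hz]
    simp only [inv_inv, inv_pow, inv_eq_of_mul_eq_one_right h2]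
    ring

lemma S_sub_two_eval_neg_two (n : ℕ) :
    (Chebyshev.S ℤ (n - 2)).eval (-2) = (-1) ^ n * ((n : ℤ) - 1) := by
  rw [Chebyshev.S_eval_neg_two, Int.negOnePow_sub, Int.negOnePow_even 2 (by decide)]
  simp only [mul_one, Int.negOnePow_def, zpow_natCast]
  push_cast
  ring

/-- The coefficient is `n - 1` where the outer factor of the measure has `-1`: the two agree only
modulo `n`, which suffices for primes dividing `n`. -/
lemma measurePoly_eval_two (n : ℕ) (A B A' B' : ℤ[X]) :
    (measurePoly n A B A' B').eval 2 = (A.eval 2 + B.eval 2) ^ 2 +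
      ((n : ℤ) - 1) * (A'.eval 2 + B'.eval 2) ^ 2 := by
  have h : (Chebyshev.S ℤ ((n : ℤ) - 2)).eval 2 = (n : ℤ) - 1 := by
    rw [Chebyshev.S_eval_two]; push_cast; ring
  simp only [measurePoly, normPoly, eval_add, eval_mul, eval_pow, eval_X, h]
  ring

lemma measurePoly_eval_neg_two (n : ℕ) (A B A' B' : ℤ[X]) :
    (measurePoly n A B A' B').eval (-2) = (A.eval (-2) - B.eval (-2)) ^ 2 +
      (-1) ^ n * ((n : ℤ) - 1) * (A'.eval (-2) - B'.eval (-2)) ^ 2 := by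
  simp only [measurePoly, normPoly, eval_add, eval_mul, eval_pow, eval_X, S_sub_two_eval_neg_two]
  ring

/-! ### The lower bound `2α + 1`, valid for every prime. -/

lemma prime_dvd_res_comp_iff (p : ℕ) [Fact p.Prime] {n : ℕ} (hn : 0 < n) (h : ℤ[X]) :
    (p : ℤ) ∣ res ((Chebyshev.S ℤ (p - 1)).comp (Chebyshev.C ℤ n)) h ↔
      (p : ℤ) ∣ h.eval 2 * h.eval (-2) * res (Chebyshev.S ℤ (n - 1)) h := by
  have hp : p.Prime := Fact.out
  have hpZ : Prime (p : ℤ) := Nat.prime_iff_prime_int.mp hp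
  have hE : ((Chebyshev.S ℤ (p - 1)).comp (Chebyshev.C ℤ n)).Monic :=
    (S_sub_one_monic hp.pos).comp (C_monic hn) (by rw [natDegree_C_eq hn]; exact hn.ne')
  have hS := S_sub_one_monic hn
  have hL : ((X - C 2) * (X - C (-2)) : ℤ[X]).Monic := (monic_X_sub_C _).mul (monic_X_sub_C _)
  have hd := res_modEq_of_map_eq (hE.pow 2) ((hL.mul (hS.pow 2)).pow (p - 1))
    (map_S_comp_C_sq p n) h
  rw [res_pow hE.ne_zero, res_pow (hL.mul (hS.pow 2)).ne_zero,
    res_mul hL.ne_zero (hS.pow 2).ne_zero, res_pow hS.ne_zero,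
    res_mul (X_sub_C_ne_zero _) (X_sub_C_ne_zero _), res_X_sub_C, res_X_sub_C] at hd
  have hp1 : p - 1 ≠ 0 := by have := hp.two_le; lia
  -- The congruence is known only for the square of the composed factor, so divisibility by `p` is
  -- tested on squares and powers.
  rw [← hpZ.dvd_pow_iff_dvd two_ne_zero, ← dvd_iff_dvd_of_dvd_sub (dvd_sub_comm.mp hd),
    hpZ.dvd_pow_iff_dvd hp1, hpZ.dvd_mul, hpZ.dvd_pow_iff_dvd two_ne_zero, ← hpZ.dvd_mul]

/-- The equivalence is carried through the induction so that every new factor has the same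
divisibility criterion, stated at the base level `r`; `K` collects the `a` factors. -/
lemma res_S_prime_pow_mul (p : ℕ) [Fact p.Prime] {r : ℕ} (hr : 0 < r) (h : ℤ[X]) (a : ℕ) :
    ((p : ℤ) ∣ h.eval 2 * h.eval (-2) * res (Chebyshev.S ℤ ((p ^ a * r : ℕ) - 1)) h ↔
      (p : ℤ) ∣ h.eval 2 * h.eval (-2) * res (Chebyshev.S ℤ (r - 1)) h) ∧
    ∃ K, res (Chebyshev.S ℤ ((p ^ a * r : ℕ) - 1)) h = res (Chebyshev.S ℤ (r - 1)) h * K ∧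
      ((p : ℤ) ∣ h.eval 2 * h.eval (-2) * res (Chebyshev.S ℤ (r - 1)) h → (p : ℤ) ^ a ∣ K) := by
  have hp : p.Prime := Fact.out
  have hpZ : Prime (p : ℤ) := Nat.prime_iff_prime_int.mp hp
  induction a with
  | zero => simpa using ⟨1, by simp⟩
  | succ a ih =>
    obtain ⟨ih1, K, hK, hKd⟩ := ih
    have hpos : 0 < p ^ a * r := Nat.mul_pos (pow_pos hp.pos _) hr
    have hE : ((Chebyshev.S ℤ (p - 1)).comp (Chebyshev.C ℤ (p ^ a * r : ℕ))).Monic :=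
      (S_sub_one_monic hp.pos).comp (C_monic hpos) (by rw [natDegree_C_eq hpos]; exact hpos.ne')
    have e : res (Chebyshev.S ℤ ((p ^ (a + 1) * r : ℕ) - 1)) h =
        res (Chebyshev.S ℤ ((p ^ a * r : ℕ) - 1)) h *
          res ((Chebyshev.S ℤ (p - 1)).comp (Chebyshev.C ℤ (p ^ a * r : ℕ))) h := by
      rw [← res_mul (S_sub_one_monic hpos).ne_zero hE.ne_zero, ← S_mul_sub_one,
        pow_succ', mul_assoc]
    have hiff := prime_dvd_res_comp_iff p hpos h
    rw [ih1] at hiff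
    rw [e]
    refine ⟨?_, K * res ((Chebyshev.S ℤ (p - 1)).comp (Chebyshev.C ℤ (p ^ a * r : ℕ))) h,
      by rw [hK, mul_assoc], fun hd => ?_⟩
    · rw [← mul_assoc, hpZ.dvd_mul, ih1, hiff, or_self]
    · rw [pow_succ]; exact mul_dvd_mul (hKd hd) (hiff.mpr hd)

theorem prime_pow_dvd_measure (p : ℕ) [Fact p.Prime] {n a : ℕ} (hn : 0 < n) (ha : p ^ a ∣ n)
    (A B A' B' : ℤ[X]) {M : ℤ}
    (hM : M = ((A.eval 2 + B.eval 2) ^ 2 - (A'.eval 2 + B'.eval 2) ^ 2) *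
      ((A.eval (-2) - B.eval (-2)) ^ 2 - (-1) ^ n * (A'.eval (-2) - B'.eval (-2)) ^ 2) *
        res (Chebyshev.S ℤ (n - 1)) (measurePoly n A B A' B') ^ 2)
    (hd : (p : ℤ) ∣ M) : (p : ℤ) ^ (2 * a + 1) ∣ M := by
  have hp : p.Prime := Fact.out
  have hpZ : Prime (p : ℤ) := Nat.prime_iff_prime_int.mp hp
  rcases Nat.eq_zero_or_pos a with rfl | ha0
  · simpa using hd
  obtain ⟨r, rfl⟩ := ha
  have hr : 0 < r := Nat.pos_of_mul_pos_left hn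
  set h := measurePoly (p ^ a * r) A B A' B' with hh
  obtain ⟨h1, K, hK, hKd⟩ := res_S_prime_pow_mul p hr h a
  have hpn : (p : ℤ) ∣ ((p ^ a * r : ℕ) : ℤ) := by
    exact_mod_cast (dvd_pow_self p ha0.ne').mul_right r
  have e2 := measurePoly_eval_two (p ^ a * r) A B A' B'
  have e3 := measurePoly_eval_neg_two (p ^ a * r) A B A' B'
  rw [← hh] at e2 e3
  set x := (A.eval 2 + B.eval 2) ^ 2 - (A'.eval 2 + B'.eval 2) ^ 2
  set y := (A.eval (-2) - B.eval (-2)) ^ 2 - (-1) ^ (p ^ a * r) *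
    (A'.eval (-2) - B'.eval (-2)) ^ 2
  have i1 : (p : ℤ) ∣ h.eval 2 ↔ (p : ℤ) ∣ x := by
    refine dvd_iff_dvd_of_dvd_sub (Dvd.dvd.trans hpn ⟨(A'.eval 2 + B'.eval 2) ^ 2, ?_⟩)
    rw [e2]; ring
  have i2 : (p : ℤ) ∣ h.eval (-2) ↔ (p : ℤ) ∣ y := by
    refine dvd_iff_dvd_of_dvd_sub
      (Dvd.dvd.trans hpn ⟨(-1) ^ (p ^ a * r) * (A'.eval (-2) - B'.eval (-2)) ^ 2, ?_⟩)
    rw [e3]; ring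
  have hxy : ∀ c : ℤ, (p : ℤ) ∣ h.eval 2 * h.eval (-2) * c ↔ (p : ℤ) ∣ x * y * c ^ 2 := fun c => by
    rw [hpZ.dvd_mul, hpZ.dvd_mul, hpZ.dvd_mul, hpZ.dvd_mul, i1, i2, hpZ.dvd_pow_iff_dvd two_ne_zero]
  rw [hM] at hd ⊢
  have hd' := h1.mp ((hxy _).mpr hd)
  rw [hK, mul_pow, ← mul_assoc, pow_succ', mul_comm 2, pow_mul]
  exact mul_dvd_mul ((hxy _).mp hd') (pow_dvd_pow_of_dvd (hKd hd') 2)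

/-! ### The prime two: parity of the Chebyshev factors. -/

lemma two_dvd_res_C_two_mul_iff {n : ℕ} (hn : 0 < n) (h : ℤ[X]) :
    2 ∣ res (Chebyshev.C ℤ (2 * n : ℕ)) h ↔ 2 ∣ res (Chebyshev.C ℤ n) h := by
  have hC := C_monic hn
  have hd := res_modEq_of_map_eq (p := 2) (C_monic (n := 2 * n) (by lia)) (hC.pow 2) (by
    rw [C_two_mul, Polynomial.map_sub, Polynomial.map_ofNat, sub_eq_self]
    exact CharTwo.two_eq_zero) h
  rw [res_pow hC.ne_zero] at hd
  rw [Nat.cast_ofNat] at hd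
  rw [dvd_iff_dvd_of_dvd_sub hd, Int.prime_two.dvd_pow_iff_dvd two_ne_zero]

/-- Modulo 2, `C_{2k+1} = (X - 2)V² + 2` becomes `X V²`. -/
lemma two_dvd_res_C_odd_iff (k : ℕ) (h : ℤ[X]) :
    2 ∣ res (Chebyshev.C ℤ (2 * k + 1 : ℕ)) h ↔ 2 ∣ h.eval 0 * res (oddMinus k) h := by
  have hV := oddMinus_monic k
  have hd := res_modEq_of_map_eq (p := 2) (C_monic (n := 2 * k + 1) (by lia))
    (monic_X.mul (hV.pow 2)) (by
      have h2 : (2 : (ZMod 2)[X]) = 0 := CharTwo.two_eq_zero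
      rw [C_two_mul_add_one, Polynomial.map_add, Polynomial.map_mul, Polynomial.map_sub,
        Polynomial.map_ofNat, h2, add_zero, sub_zero, Polynomial.map_mul]) h
  rw [res_mul X_ne_zero (hV.pow 2).ne_zero, res_pow hV.ne_zero, res_X] at hd
  rw [Nat.cast_ofNat] at hd
  rw [dvd_iff_dvd_of_dvd_sub hd, Int.prime_two.dvd_mul,
    Int.prime_two.dvd_pow_iff_dvd two_ne_zero, Int.prime_two.dvd_mul]

lemma map_oddPlus (k : ℕ) : (oddPlus k).map (Int.castRingHom (ZMod 2)) =
    (oddMinus k).map (Int.castRingHom (ZMod 2)) := by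
  simp only [oddPlus, oddMinus, Polynomial.map_add, Polynomial.map_sub, CharTwo.sub_eq_add]

lemma oddMinus_add_two (k : ℕ) : oddMinus (k + 2) = X * oddMinus (k + 1) - oddMinus k := by
  have h1 := Chebyshev.S_add_two ℤ k
  have h2 := Chebyshev.S_add_two ℤ ((k : ℤ) - 1)
  rw [show (k : ℤ) - 1 + 2 = k + 1 by ring, sub_add_cancel] at h2
  simp only [oddMinus]
  push_cast
  rw [show (k : ℤ) + 2 - 1 = k + 1 by ring, add_sub_cancel_right, h1, h2]
  ring

lemma oddPlus_add_two (k : ℕ) : oddPlus (k + 2) = X * oddPlus (k + 1) - oddPlus k := by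
  have h1 := Chebyshev.S_add_two ℤ k
  have h2 := Chebyshev.S_add_two ℤ ((k : ℤ) - 1)
  rw [show (k : ℤ) - 1 + 2 = k + 1 by ring, sub_add_cancel] at h2
  simp only [oddPlus]
  push_cast
  rw [show (k : ℤ) + 2 - 1 = k + 1 by ring, add_sub_cancel_right, h1, h2]
  ring

lemma oddMinus_eval_zero_odd (k : ℕ) : Odd ((oddMinus k).eval 0) := by
  induction k using Nat.twoStepInduction with
  | zero => simp [oddMinus]
  | one => simp [oddMinus]
  | more k ih _ => rw [oddMinus_add_two]; simpa using ih

/-- The recurrence at 1 has period 6, so `V(1)` is even only when `k ≡ 1` modulo 3, that is when `3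
∣ 2k + 1`. -/
lemma oddMinus_eval_one (k : ℕ) :
    ((oddMinus (3 * k)).eval 1) ^ 2 = 1 ∧
    (oddMinus (3 * k + 1)).eval 1 = 2 * (oddMinus (3 * k)).eval 1 := by
  induction k with
  | zero => simp [oddMinus]
  | succ k ih =>
    obtain ⟨h1, h2⟩ := ih
    have e1 := congrArg (eval 1) (oddMinus_add_two (3 * k))
    have e2 := congrArg (eval 1) (oddMinus_add_two (3 * k + 1))
    have e3 := congrArg (eval 1) (oddMinus_add_two (3 * k + 2))
    simp only [eval_sub, eval_mul, eval_X, add_assoc, Nat.reduceAdd] at e1 e2 e3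
    rw [show 3 * (k + 1) + 1 = 3 * k + 4 by ring, show 3 * (k + 1) = 3 * k + 3 by ring, e3, e2, e1, h2]
    constructor
    · linear_combination h1
    · ring

lemma odd_oddMinus_eval_one (k : ℕ) : Odd ((oddMinus (3 * k)).eval 1) :=
  (Int.odd_pow' two_ne_zero).mp ((oddMinus_eval_one k).1.symm ▸ odd_one)

lemma oddMinus_eval_neg_one (k : ℕ) : (oddMinus (3 * k + 1)).eval (-1) = 0 := by
  induction k with
  | zero => simp [oddMinus]
  | succ k ih =>
    have e1 := congrArg (eval (-1)) (oddMinus_add_two (3 * k + 1))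
    have e2 := congrArg (eval (-1)) (oddMinus_add_two (3 * k + 2))
    simp only [eval_sub, eval_mul, eval_X, add_assoc, Nat.reduceAdd] at e1 e2
    rw [show 3 * (k + 1) + 1 = 3 * k + 4 by ring, e2, e1, ih]
    ring

lemma oddPlus_eval_one (k : ℕ) : (oddPlus (3 * k + 1)).eval 1 = 0 := by
  induction k with
  | zero => simp [oddPlus]
  | succ k ih =>
    have e1 := congrArg (eval 1) (oddPlus_add_two (3 * k + 1))
    have e2 := congrArg (eval 1) (oddPlus_add_two (3 * k + 2))
    simp only [eval_sub, eval_mul, eval_X, add_assoc, Nat.reduceAdd] at e1 e2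
    rw [show 3 * (k + 1) + 1 = 3 * k + 4 by ring, e2, e1, ih]
    ring

lemma not_isRoot_map_two {Q : ℤ[X]} (h0 : Odd (Q.eval 0)) (h1 : Odd (Q.eval 1)) (a : ZMod 2) :
    ¬ (Q.map (Int.castRingHom (ZMod 2))).IsRoot a := by
  obtain rfl | rfl : a = 0 ∨ a = 1 := by revert a; decide
  · intro h
    have := eval_intCast_map (Int.castRingHom (ZMod 2)) Q 0
    rw [Int.cast_zero, h.eq_zero, eq_comm, eq_intCast, ZMod.intCast_eq_zero_iff_even] at this
    exact Int.not_even_iff_odd.mpr h0 this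
  · intro h
    have := eval_intCast_map (Int.castRingHom (ZMod 2)) Q 1
    rw [Int.cast_one, h.eq_zero, eq_comm, eq_intCast, ZMod.intCast_eq_zero_iff_even] at this
    exact Int.not_even_iff_odd.mpr h1 this

/-- If `V ≡ W` modulo `2` have no roots modulo `2`, then `2 ∣ Res(V, h)` forces
`16 ∣ Res(V, h) Res(W, h)`. -/
lemma sixteen_dvd_res_mul_res {V W : ℤ[X]} (hV : V.Monic) (hW : W.Monic)
    (hVW : W.map (Int.castRingHom (ZMod 2)) = V.map (Int.castRingHom (ZMod 2)))
    (h0 : Odd (V.eval 0)) (h1 : Odd (V.eval 1)) {h : ℤ[X]} (hd : 2 ∣ res V h) :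
    16 ∣ res V h * res W h := by
  have hdW : (2 : ℤ) ∣ res W h :=
    (dvd_iff_dvd_of_dvd_sub (res_modEq_of_map_eq hW hV hVW h)).mpr hd
  have hr := not_isRoot_map_two h0 h1
  have e1 := sq_dvd_res_of_no_root (p := 2) hV hr hd
  have e2 := sq_dvd_res_of_no_root (p := 2) hW (by rwa [hVW]) hdW
  exact mul_dvd_mul e1 e2

lemma exists_eq_comp_sq_add (h : ℤ[X]) :
    ∃ a b : ℤ[X], h = a.comp (X ^ 2) + X * b.comp (X ^ 2) := by
  induction h using Polynomial.induction_on with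
  | C c => exact ⟨C c, 0, by simp⟩
  | add f g hf hg =>
    obtain ⟨a, b, h⟩ := hf
    obtain ⟨a', b', h'⟩ := hg
    exact ⟨a + a', b + b', by rw [h, h', add_comp, add_comp]; ring⟩
  | monomial n c ih =>
    obtain ⟨a, b, h⟩ := ih
    refine ⟨X * b, a, ?_⟩
    rw [pow_succ, ← mul_assoc, h, mul_comp, X_comp]
    ring

/-- The resultant is `h(√3) h(-√3)`, the norm of `a(3) + √3 b(3)`. -/
lemma res_X_sq_sub_three (a b : ℤ[X]) :
    res (X ^ 2 - 3) (a.comp (X ^ 2) + X * b.comp (X ^ 2)) =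
      a.eval 3 ^ 2 - 3 * b.eval 3 ^ 2 := by
  set h := a.comp (X ^ 2) + X * b.comp (X ^ 2) with hh
  have hs : √3 * √3 = (3 : ℝ) := Real.mul_self_sqrt (by norm_num)
  have hmon : (X ^ 2 - 3 : ℤ[X]).Monic := by
    rw [show (3 : ℤ[X]) = C 3 by rfl]; exact monic_X_pow_sub_C 3 two_ne_zero
  have hfac : (X ^ 2 - 3 : ℤ[X]).map (Int.castRingHom ℝ) = (X - C √3) * (X - C (-√3)) := by
    have : (C √3 * C √3 : ℝ[X]) = 3 := by rw [← C_mul, hs]; rfl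
    simp only [Polynomial.map_sub, Polynomial.map_pow, map_X, Polynomial.map_ofNat, C_neg]
    linear_combination this
  have hc : ∀ q : ℤ[X], (q.map (Int.castRingHom ℝ)).eval 3 = ((q.eval 3 : ℤ) : ℝ) := fun q => by
    simpa using eval_intCast_map (Int.castRingHom ℝ) q 3
  have hev : ∀ s : ℝ, s * s = 3 → (h.map (Int.castRingHom ℝ)).eval s =
      ((a.eval 3 : ℤ) : ℝ) + s * ((b.eval 3 : ℤ) : ℝ) := by
    intro s hs
    rw [hh]
    simp only [Polynomial.map_add, Polynomial.map_mul, Polynomial.map_comp, map_X, eval_add,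
      eval_mul, eval_comp, eval_X, sq, hs, hc]
  apply Int.cast_injective (α := ℝ)
  change Int.castRingHom ℝ _ = _
  unfold res
  rw [← resultant_map_map, ← hmon.natDegree_map (Int.castRingHom ℝ), hfac,
    natDegree_mul (X_sub_C_ne_zero _) (X_sub_C_ne_zero _),
    resultant_mul_left _ _ _ _ natDegree_map_le, natDegree_X_sub_C, natDegree_X_sub_C,
    resultant_X_sub_C_left _ _ _ natDegree_map_le, resultant_X_sub_C_left _ _ _ natDegree_map_le,
    hev _ hs, hev _ (by rw [neg_mul_neg, hs])]
  push_cast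
  linear_combination (-((b.eval 3 : ℤ) : ℝ) ^ 2) * hs

/-- If `T` is even all four numbers are, giving `4 · 4`. If `T` is odd, `P² - T²` is divisible by 8
and `Q² - 3D²` is even. -/
lemma sixteen_dvd_of_parity {P T Q D : ℤ} (hPQ : 2 ∣ Q - P) (hTD : 2 ∣ D - T)
    (h : 2 ∣ P - T) : 16 ∣ (P - T) * (P + T) * (Q ^ 2 - 3 * D ^ 2) := by
  obtain ⟨u, hu⟩ := hPQ
  obtain ⟨v, hv⟩ := hTD
  obtain ⟨w, hw⟩ := h
  obtain rfl : Q = P + 2 * u := by linarith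
  obtain rfl : D = T + 2 * v := by linarith
  obtain rfl : P = T + 2 * w := by linarith
  obtain ⟨t, rfl | rfl⟩ := Int.even_or_odd' T
  · have h1 : (2 * t + 2 * w + 2 * u) ^ 2 - 3 * (2 * t + 2 * v) ^ 2 =
      4 * ((t + w + u) ^ 2 - 3 * (t + v) ^ 2) := by ring
    have h2 : (2 * t + 2 * w - 2 * t) * (2 * t + 2 * w + 2 * t) = 4 * (w * (2 * t + w)) := by ring
    rw [h1, h2]
    exact mul_dvd_mul (a := 4) (c := 4) ⟨_, rfl⟩ ⟨_, rfl⟩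
  · have h3 : 2 ∣ w * (w + 2 * t + 1) := by
      rcases Int.even_or_odd' w with ⟨s, rfl | rfl⟩
      · exact ⟨s * (2 * s + 2 * t + 1), by ring⟩
      · exact ⟨(2 * s + 1) * (s + t + 1), by ring⟩
    obtain ⟨s, hs⟩ := h3
    have h4 : (2 * t + 1 + 2 * w + 2 * u) ^ 2 - 3 * (2 * t + 1 + 2 * v) ^ 2 =
      2 * (2 * (t + w + u) ^ 2 + 2 * (t + w + u) - 6 * (t + v) ^ 2 - 6 * (t + v) - 1) := by ring
    refine ⟨s * (2 * (t + w + u) ^ 2 + 2 * (t + w + u) - 6 * (t + v) ^ 2 - 6 * (t + v) - 1), ?_⟩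
    rw [h4]
    linear_combination 8 * (2 * (t + w + u) ^ 2 + 2 * (t + w + u) - 6 * (t + v) ^ 2 -
      6 * (t + v) - 1) * hs

lemma sixteen_dvd_eval_mul_res {h : ℤ[X]} (hd : 2 ∣ h.eval (-1)) :
    16 ∣ h.eval (-1) * h.eval 1 * res (X ^ 2 - 3) h := by
  obtain ⟨a, b, rfl⟩ := exists_eq_comp_sq_add h
  rw [res_X_sq_sub_three]
  have e1 : (a.comp (X ^ 2) + X * b.comp (X ^ 2)).eval (-1) = a.eval 1 - b.eval 1 := by
    simp [eval_comp]; ring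
  have e2 : (a.comp (X ^ 2) + X * b.comp (X ^ 2)).eval 1 = a.eval 1 + b.eval 1 := by
    simp [eval_comp]
  rw [e1] at hd ⊢
  rw [e2]
  refine sixteen_dvd_of_parity ?_ ?_ hd
  · simpa using sub_dvd_eval_sub 3 1 a
  · simpa using sub_dvd_eval_sub 3 1 b

lemma sixteen_dvd_res_odd {k : ℕ} {h : ℤ[X]} (hd : 2 ∣ res (oddMinus k) h) :
    16 ∣ res (oddMinus k) h * res (oddPlus k) h * res (Chebyshev.C ℤ (2 * k + 1 : ℕ)) h := by
  have hV := oddMinus_monic k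
  have hW := oddPlus_monic k
  have h0 := oddMinus_eval_zero_odd k
  -- When `3 ∣ 2k + 1`, `V` has the root 1 modulo 2. The linear factors `X + 1` of `V` and `X - 1`
  -- of `W` are split off and combined with `X² - 3` from `C_{2k+1}`; the cofactors have no roots
  -- modulo 2.
  by_cases hk : 3 ∣ 2 * k + 1
  · obtain ⟨j, rfl⟩ : ∃ j, k = 3 * j + 1 := ⟨k / 3, by lia⟩
    obtain ⟨E, hE⟩ := X_mul_dvd_C_odd hk
    obtain ⟨V, hV'⟩ := dvd_iff_isRoot.mpr (oddMinus_eval_neg_one j)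
    obtain ⟨W, hW'⟩ := dvd_iff_isRoot.mpr (oddPlus_eval_one j)
    have hVm : V.Monic := (monic_X_sub_C _).of_mul_monic_left (hV' ▸ hV)
    have hWm : W.Monic := (monic_X_sub_C _).of_mul_monic_left (hW' ▸ hW)
    have hC := C_monic (n := 2 * (3 * j + 1) + 1) (by lia)
    rw [hE] at hC
    have hE0 : E ≠ 0 := fun h => hC.ne_zero (by rw [h, mul_zero])
    have hX0 : (X * (X ^ 2 - 3) : ℤ[X]) ≠ 0 := fun h => hC.ne_zero (by rw [h, zero_mul])
    have hX1 : (X ^ 2 - 3 : ℤ[X]) ≠ 0 := right_ne_zero_of_mul hX0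
    rw [hV', res_mul (X_sub_C_ne_zero _) hVm.ne_zero, res_X_sub_C] at hd ⊢
    rw [hW', hE, res_mul (X_sub_C_ne_zero _) hWm.ne_zero, res_X_sub_C, res_mul hX0 hE0,
      res_mul X_ne_zero hX1]
    rcases Int.prime_two.dvd_or_dvd hd with h2 | h2
    · refine (sixteen_dvd_eval_mul_res h2).trans ⟨res V h * res W h * res X h * res E h, ?_⟩
      ring
    · have hVW : W.map (Int.castRingHom (ZMod 2)) = V.map (Int.castRingHom (ZMod 2)) := by
        have := map_oddPlus (3 * j + 1)
        rw [hV', hW', Polynomial.map_mul, Polynomial.map_mul] at this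
        refine mul_left_cancel₀ (X_sub_C_ne_zero (1 : ZMod 2)) ?_
        simpa [CharTwo.sub_eq_add] using this
      have o1 : Odd (V.eval 1) := by
        have s2 := (oddMinus_eval_one j).2
        rw [hV'] at s2
        simp only [eval_mul, eval_sub, eval_X, eval_C] at s2
        have : V.eval 1 = (oddMinus (3 * j)).eval 1 := by linarith
        rw [this]
        exact odd_oddMinus_eval_one j
      have o0 : Odd (V.eval 0) := by
        rw [hV', eval_mul, Int.odd_mul] at h0
        exact h0.2
      refine (sixteen_dvd_res_mul_res hVm hWm hVW o0 o1 h2).trans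
        ⟨h.eval (-1) * h.eval 1 * (res X h * res (X ^ 2 - 3) h * res E h), ?_⟩
      ring
  · have h1 : Odd ((oddMinus k).eval 1) := by
      obtain ⟨j, rfl | rfl⟩ : ∃ j, k = 3 * j ∨ k = 3 * j + 2 := ⟨k / 3, by lia⟩
      · exact odd_oddMinus_eval_one j
      · have s2 := (oddMinus_eval_one j).2
        have s3 := congrArg (eval 1) (oddMinus_add_two (3 * j))
        simp only [eval_sub, eval_mul, eval_X] at s3
        have : (oddMinus (3 * j + 2)).eval 1 = (oddMinus (3 * j)).eval 1 := by linarith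
        rw [this]
        exact odd_oddMinus_eval_one j
    exact (sixteen_dvd_res_mul_res hV hW (map_oddPlus k) h0 h1 hd).mul_right _

lemma two_dvd_res_C_two_pow_iff (k a : ℕ) (h : ℤ[X]) :
    2 ∣ res (Chebyshev.C ℤ (2 ^ a * (2 * k + 1) : ℕ)) h ↔ 2 ∣ h.eval 0 * res (oddMinus k) h := by
  induction a with
  | zero => rw [pow_zero, one_mul, two_dvd_res_C_odd_iff]
  | succ a ih => rw [pow_succ', mul_assoc, two_dvd_res_C_two_mul_iff (by positivity), ih]

lemma res_oddPlus_even_iff (k : ℕ) (h : ℤ[X]) : 2 ∣ res (oddPlus k) h ↔ 2 ∣ res (oddMinus k) h :=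
  dvd_iff_dvd_of_dvd_sub
    (res_modEq_of_map_eq (p := 2) (oddPlus_monic k) (oddMinus_monic k) (map_oddPlus k) h)

lemma res_S_odd (k : ℕ) (h : ℤ[X]) : res (Chebyshev.S ℤ ((2 * k + 1 : ℕ) - 1)) h =
    res (oddMinus k) h * res (oddPlus k) h := by
  rw [S_two_mul, res_mul (oddMinus_monic k).ne_zero (oddPlus_monic k).ne_zero]

/-- `K` is the product of the resultants with `C_{2^i(2k+1)}` for `1 ≤ i ≤ a`, all of the same
parity. The factor with `i = 0` is kept apart because it contributes to the `2^8`. -/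
lemma res_S_two_pow (k a : ℕ) (h : ℤ[X]) :
    ∃ K, res (Chebyshev.S ℤ ((2 ^ (a + 1) * (2 * k + 1) : ℕ) - 1)) h =
      res (oddMinus k) h * res (oddPlus k) h * res (Chebyshev.C ℤ (2 * k + 1 : ℕ)) h * K ∧
      (2 ∣ h.eval 0 * res (oddMinus k) h → 2 ^ a ∣ K) ∧
      (2 ∣ K → 2 ∣ h.eval 0 * res (oddMinus k) h) := by
  have step : ∀ m : ℕ, 0 < m → res (Chebyshev.S ℤ ((2 * m : ℕ) - 1)) h =
      res (Chebyshev.S ℤ (m - 1)) h * res (Chebyshev.C ℤ m) h := fun m hm => by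
    rw [S_two_mul_sub_one, res_mul (S_sub_one_monic hm).ne_zero (C_monic hm).ne_zero]
  induction a with
  | zero =>
    refine ⟨1, ?_, by simp, by norm_num⟩
    rw [zero_add, pow_one, step _ (by lia), res_S_odd, mul_one]
  | succ a ih =>
    obtain ⟨K, hK, h1, h2⟩ := ih
    have hiff := two_dvd_res_C_two_pow_iff k (a + 1) h
    refine ⟨K * res (Chebyshev.C ℤ (2 ^ (a + 1) * (2 * k + 1) : ℕ)) h, ?_, fun hd => ?_,
      fun hd => ?_⟩
    · rw [pow_succ', mul_assoc, step _ (by positivity), hK, mul_assoc]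
    · rw [pow_succ]; exact mul_dvd_mul (h1 hd) (hiff.mpr hd)
    · exact (Int.prime_two.dvd_or_dvd hd).elim h2 hiff.mp

/-! ### The prime two: values at 0 and ±1, and the lower bounds. -/

lemma S_even_eval_zero (j : ℕ) : (Chebyshev.S ℤ (2 * j : ℕ)).eval 0 = 1 ∨
    (Chebyshev.S ℤ (2 * j : ℕ)).eval 0 = -1 := by
  induction j with
  | zero => simp
  | succ j ih =>
    have h := congrArg (eval 0) (Chebyshev.S_add_two ℤ ((2 * j : ℕ) : ℤ))
    rw [show ((2 * j : ℕ) : ℤ) + 2 = (2 * (j + 1) : ℕ) by push_cast; ring, eval_sub, eval_mul,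
      eval_X, zero_mul, zero_sub] at h
    rw [h]
    rcases ih with ih | ih <;> rw [ih] <;> norm_num

lemma eight_dvd_sq_sub_sq {u v : ℤ} (hu : Odd u) (hv : Odd v) : 8 ∣ u ^ 2 - v ^ 2 := by
  obtain ⟨s, rfl⟩ := hu
  obtain ⟨t, rfl⟩ := hv
  obtain ⟨i, hi⟩ := Int.even_mul_succ_self s
  obtain ⟨j, hj⟩ := Int.even_mul_succ_self t
  exact ⟨i - j, by linear_combination 4 * hi - 4 * hj⟩

lemma four_dvd_sq_sub_sq {u v : ℤ} (hu : Even u) (hv : Even v) : 4 ∣ u ^ 2 - v ^ 2 := by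
  obtain ⟨s, rfl⟩ := hu
  obtain ⟨t, rfl⟩ := hv
  exact ⟨s ^ 2 - t ^ 2, by ring⟩

lemma sixteen_dvd_sq_sub_sq {u v : ℤ} (hv : Even v) (h : 4 ∣ u - v) : 16 ∣ u ^ 2 - v ^ 2 := by
  obtain ⟨t, rfl⟩ := hv
  obtain ⟨s, hs⟩ := h
  exact ⟨s * (s + t), by linear_combination (u + (t + t)) * hs + 4 * s * hs⟩

lemma even_iff_of_even_sq_sub {u v : ℤ} (h : 2 ∣ u ^ 2 - v ^ 2) : Even u ↔ Even v := by
  have h1 : Even (u ^ 2 - v ^ 2) := even_iff_two_dvd.mpr h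
  rw [Int.even_sub, Int.even_pow' two_ne_zero, Int.even_pow' two_ne_zero] at h1
  exact h1

/-- Here `u, u' = f(±1)`, `v, v' = g(±1)`, and the last factor is `h(0)²`. The powers of 2 split as
`8·8·4` for odd values, as `4·4·16` for even values with `a ≡ c` modulo 2, and otherwise as `16·4·4`
or `4·16·4`. -/
lemma two_pow_eight_dvd_of_even {u u' v v' a b c d e : ℤ} (hu : 4 ∣ u + u' - 2 * a)
    (hv : 4 ∣ v + v' - 2 * c) (hab : 2 ∣ u - (a + b)) (hcd : 2 ∣ v - (c + d))
    (he : e = 1 ∨ e = -1) (hd : 2 ∣ u ^ 2 - v ^ 2) :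
    2 ^ 8 ∣ (u ^ 2 - v ^ 2) * (u' ^ 2 - v' ^ 2) * (a ^ 2 + b ^ 2 + e * (c ^ 2 + d ^ 2)) ^ 2 := by
  have huv := even_iff_of_even_sq_sub hd
  have hu' : Even u' ↔ Even u := by rw [Int.even_iff, Int.even_iff]; lia
  have hv' : Even v' ↔ Even v := by rw [Int.even_iff, Int.even_iff]; lia
  have hab' : Even u ↔ Even (a + b) := by rw [Int.even_iff, Int.even_iff]; lia
  have hcd' : Even v ↔ Even (c + d) := by rw [Int.even_iff, Int.even_iff]; lia
  have he' : Odd e := by rcases he with rfl | rfl <;> decide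
  have h0 : 2 ∣ a ^ 2 + b ^ 2 + e * (c ^ 2 + d ^ 2) := by
    rw [← even_iff_two_dvd]
    have : ¬ Even e := Int.not_even_iff_odd.mpr he'
    simp only [Int.even_add, Int.even_mul, Int.even_pow' two_ne_zero] at hab' hcd' ⊢
    tauto
  by_cases hev : Even u
  · have hev2 := huv.mp hev
    have hev3 := hu'.mpr hev
    have hev4 := hv'.mpr hev2
    have e1 := four_dvd_sq_sub_sq hev hev2
    have e2 := four_dvd_sq_sub_sq hev3 hev4
    by_cases hac : 2 ∣ a - c
    · have h4 : 4 ∣ a ^ 2 + b ^ 2 + e * (c ^ 2 + d ^ 2) := by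
        obtain ⟨i, hi⟩ := hac
        obtain ⟨j, hj⟩ := hab'.mp hev
        obtain ⟨l, hl⟩ := hcd'.mp hev2
        obtain rfl : a = c + 2 * i := by linarith
        obtain rfl : b = j + j - (c + 2 * i) := by linarith
        obtain rfl : d = l + l - c := by linarith
        rcases he with rfl | rfl
        · exact ⟨c ^ 2 + 2 * c * i + 2 * i ^ 2 + j ^ 2 - j * (c + 2 * i) + l ^ 2 - l * c, by ring⟩
        · exact ⟨2 * c * i + 2 * i ^ 2 + j ^ 2 - j * (c + 2 * i) - l ^ 2 + l * c, by ring⟩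
      exact mul_dvd_mul (a := 4 * 4) (c := 4 ^ 2) (mul_dvd_mul e1 e2) (pow_dvd_pow_of_dvd h4 2)
    · have h2 := pow_dvd_pow_of_dvd h0 2
      -- Both differences are even, and their sum is `2(a - c) ≡ 2` modulo 4, so exactly one is
      -- divisible by 4.
      have hor : 4 ∣ u - v ∨ 4 ∣ u' - v' := by
        rw [Int.even_iff] at hev hev2 hev3 hev4
        lia
      rcases hor with h | h
      · exact mul_dvd_mul (a := 16 * 4) (c := 2 ^ 2)
          (mul_dvd_mul (sixteen_dvd_sq_sub_sq hev2 h) e2) h2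
      · exact mul_dvd_mul (a := 4 * 16) (c := 2 ^ 2)
          (mul_dvd_mul e1 (sixteen_dvd_sq_sub_sq hev4 h)) h2
  · have o1 := Int.not_even_iff_odd.mp hev
    have o2 := Int.not_even_iff_odd.mp (huv.not.mp hev)
    have o3 := Int.not_even_iff_odd.mp (hu'.not.mpr hev)
    have o4 := Int.not_even_iff_odd.mp (hv'.not.mpr (huv.not.mp hev))
    exact mul_dvd_mul (a := 8 * 8) (c := 2 ^ 2)
      (mul_dvd_mul (eight_dvd_sq_sub_sq o1 o2) (eight_dvd_sq_sub_sq o3 o4))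
      (pow_dvd_pow_of_dvd h0 2)

lemma sixteen_dvd_of_odd {u u' v v' : ℤ} (hu : 2 ∣ u - u') (hv : 2 ∣ v - v')
    (hd : 2 ∣ u ^ 2 - v ^ 2) : 16 ∣ (u ^ 2 - v ^ 2) * (u' ^ 2 + v' ^ 2) := by
  have huv := even_iff_of_even_sq_sub hd
  have hu' : Even u' ↔ Even u := by rw [Int.even_iff, Int.even_iff]; lia
  have hv' : Even v' ↔ Even v := by rw [Int.even_iff, Int.even_iff]; lia
  by_cases hev : Even u
  · obtain ⟨i, hi⟩ := hu'.mpr hev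
    obtain ⟨j, hj⟩ := hv'.mpr (huv.mp hev)
    exact mul_dvd_mul (a := 4) (c := 4) (four_dvd_sq_sub_sq hev (huv.mp hev))
      ⟨i ^ 2 + j ^ 2, by rw [hi, hj]; ring⟩
  · obtain ⟨i, hi⟩ := Int.not_even_iff_odd.mp (hu'.not.mpr hev)
    obtain ⟨j, hj⟩ := Int.not_even_iff_odd.mp (hv'.not.mpr (huv.not.mp hev))
    exact mul_dvd_mul (a := 8) (c := 2) (eight_dvd_sq_sub_sq (Int.not_even_iff_odd.mp hev)
      (Int.not_even_iff_odd.mp (huv.not.mp hev)))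
      ⟨2 * i ^ 2 + 2 * i + 2 * j ^ 2 + 2 * j + 1, by rw [hi, hj]; ring⟩

/-- Either the outer factors supply 16, or `Res(V,h)` and `Res(W,h)` are both even and their product
is squared. No relation between `h` and the outer values is needed. -/
theorem two_pow_four_dvd_measure {n : ℕ} (hn : Odd n) (A B A' B' h : ℤ[X]) {M : ℤ}
    (hM : M = ((A.eval 2 + B.eval 2) ^ 2 - (A'.eval 2 + B'.eval 2) ^ 2) *
      ((A.eval (-2) - B.eval (-2)) ^ 2 - (-1) ^ n * (A'.eval (-2) - B'.eval (-2)) ^ 2) *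
        res (Chebyshev.S ℤ (n - 1)) h ^ 2)
    (hd : 2 ∣ M) : 2 ^ 4 ∣ M := by
  have c : ∀ q : ℤ[X], 4 ∣ q.eval 2 - q.eval (-2) := fun q => by
    simpa using sub_dvd_eval_sub 2 (-2) q
  have cA := c A
  have cB := c B
  have cA' := c A'
  have cB' := c B'
  rw [hn.neg_one_pow, neg_one_mul, sub_neg_eq_add] at hM
  obtain ⟨k, rfl⟩ := hn
  rw [res_S_odd] at hM
  set u := A.eval 2 + B.eval 2 with hu
  set u' := A.eval (-2) - B.eval (-2) with hu'
  set v := A'.eval 2 + B'.eval 2 with hv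
  set v' := A'.eval (-2) - B'.eval (-2) with hv'
  have huu : 2 ∣ u - u' := by lia
  have hvv : 2 ∣ v - v' := by lia
  have hpar : 2 ∣ u' ^ 2 + v' ^ 2 → 2 ∣ u ^ 2 - v ^ 2 := by
    rw [← even_iff_two_dvd, ← even_iff_two_dvd, Int.even_add, Int.even_sub]
    simp only [Int.even_pow' two_ne_zero]
    simp only [Int.even_iff]
    lia
  rw [hM] at hd ⊢
  have hx : 2 ∣ u ^ 2 - v ^ 2 ∨ 2 ∣ res (oddMinus k) h := by
    rw [Int.prime_two.dvd_mul, Int.prime_two.dvd_mul, Int.prime_two.dvd_pow_iff_dvd two_ne_zero,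
      Int.prime_two.dvd_mul, res_oddPlus_even_iff] at hd
    tauto
  rcases hx with hx | hx
  · exact (sixteen_dvd_of_odd huu hvv hx).mul_right _
  · have h4 := mul_dvd_mul hx ((res_oddPlus_even_iff k h).mpr hx)
    exact (pow_dvd_pow_of_dvd h4 2).mul_left _

theorem two_pow_dvd_measure {k a : ℕ} (A B A' B' : ℤ[X]) {n : ℕ}
    (hn : n = 2 ^ (a + 1) * (2 * k + 1)) {M : ℤ}
    (hM : M = ((A.eval 2 + B.eval 2) ^ 2 - (A'.eval 2 + B'.eval 2) ^ 2) *
      ((A.eval (-2) - B.eval (-2)) ^ 2 - (-1) ^ n * (A'.eval (-2) - B'.eval (-2)) ^ 2) *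
        res (Chebyshev.S ℤ (n - 1)) (measurePoly n A B A' B') ^ 2)
    (hd : 2 ∣ M) : 2 ^ (2 * (a + 1) + 6) ∣ M := by
  have c : ∀ q : ℤ[X], 4 ∣ q.eval 2 - q.eval (-2) ∧ 2 ∣ q.eval 2 - q.eval 0 := fun q =>
    ⟨by simpa using sub_dvd_eval_sub 2 (-2) q, by simpa using sub_dvd_eval_sub 2 0 q⟩
  have cA := c A
  have cB := c B
  have cA' := c A'
  have cB' := c B'
  have hne : n = 2 * (2 ^ a * (2 * k + 1)) := by rw [hn]; ring
  rw [Even.neg_one_pow (by rw [hne]; exact even_two_mul _), one_mul] at hM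
  obtain ⟨m, hm⟩ : ∃ m, n = 2 * m + 2 := by
    obtain ⟨m, hm⟩ := Nat.exists_eq_add_of_lt (show 0 < 2 ^ a * (2 * k + 1) by positivity)
    exact ⟨m, by rw [hne, hm]; ring⟩
  set h := measurePoly n A B A' B' with hh
  obtain ⟨e, he, hh0⟩ : ∃ e : ℤ, (e = 1 ∨ e = -1) ∧
      h.eval 0 = A.eval 0 ^ 2 + B.eval 0 ^ 2 + e * (A'.eval 0 ^ 2 + B'.eval 0 ^ 2) := by
    refine ⟨_, S_even_eval_zero m, ?_⟩
    rw [hh, measurePoly, hm, show ((2 * m + 2 : ℕ) : ℤ) - 2 = (2 * m : ℕ) by push_cast; ring]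
    simp only [normPoly, eval_add, eval_mul, eval_pow, eval_X]
    ring
  obtain ⟨K, hK, hK1, hK2⟩ := res_S_two_pow k a h
  obtain ⟨E, hE⟩ := X_dvd_C_odd k
  have hE0 : E ≠ 0 := by
    rintro rfl
    exact (C_monic (n := 2 * k + 1) (by lia)).ne_zero (by rw [hE, mul_zero])
  have hC : res (Chebyshev.C ℤ (2 * k + 1 : ℕ)) h = h.eval 0 * res E h := by
    rw [hE, res_mul X_ne_zero hE0, res_X]
  rw [← hn] at hK
  set u := A.eval 2 + B.eval 2 with hu
  set u' := A.eval (-2) - B.eval (-2) with hu'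
  set v := A'.eval 2 + B'.eval 2 with hv
  set v' := A'.eval (-2) - B'.eval (-2) with hv'
  have par : ∀ s t : ℤ, 2 ∣ s ^ 2 - t ^ 2 ↔ s % 2 = t % 2 := fun s t => by
    rw [← even_iff_two_dvd, Int.even_sub]
    simp only [Int.even_pow' two_ne_zero, Int.even_iff]
    lia
  have hx0 : 2 ∣ h.eval 0 ↔ 2 ∣ u ^ 2 - v ^ 2 := by
    have he' : ¬ Even e := by rcases he with rfl | rfl <;> decide
    rw [par, hh0, ← even_iff_two_dvd]
    simp only [Int.even_add, Int.even_mul, Int.even_pow' two_ne_zero, he', false_or]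
    simp only [Int.even_iff]
    lia
  have hxy : 2 ∣ u' ^ 2 - v' ^ 2 ↔ 2 ∣ u ^ 2 - v ^ 2 := by rw [par, par]; lia
  have hd' : 2 ∣ h.eval 0 * res (oddMinus k) h := by
    rw [hM, hK] at hd
    simp only [Int.prime_two.dvd_mul, Int.prime_two.dvd_pow_iff_dvd two_ne_zero,
      res_oddPlus_even_iff, hxy] at hd
    rcases hd with (hd | hd) | (((hd | hd) | hd) | hd)
    · exact (hx0.mpr hd).mul_right _
    · exact (hx0.mpr hd).mul_right _
    · exact hd.mul_left _
    · exact hd.mul_left _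
    · exact (two_dvd_res_C_odd_iff k h).mp hd
    · exact hK2 hd
  have hKd := pow_dvd_pow_of_dvd (hK1 hd') 2
  rw [hM, hK, mul_pow, ← mul_assoc, show 2 * (a + 1) + 6 = 8 + a * 2 by ring, pow_add, pow_mul]
  refine mul_dvd_mul ?_ hKd
  rcases Int.prime_two.dvd_or_dvd hd' with hx | hx
  · have hl1 : 4 ∣ u + u' - 2 * A.eval 0 := by lia
    have hl2 : 4 ∣ v + v' - 2 * A'.eval 0 := by lia
    have hl3 : 2 ∣ u - (A.eval 0 + B.eval 0) := by lia
    have hl4 : 2 ∣ v - (A'.eval 0 + B'.eval 0) := by lia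
    have := two_pow_eight_dvd_of_even (u := u) (u' := u') (v := v) (v' := v') (a := A.eval 0)
      (b := B.eval 0) (c := A'.eval 0) (d := B'.eval 0) hl1 hl2 hl3 hl4 he
      (hx0.mp hx)
    rw [← hh0] at this
    have e1 : (u ^ 2 - v ^ 2) * (u' ^ 2 - v' ^ 2) *
        (res (oddMinus k) h * res (oddPlus k) h * res (Chebyshev.C ℤ (2 * k + 1 : ℕ)) h) ^ 2 =
        (u ^ 2 - v ^ 2) * (u' ^ 2 - v' ^ 2) * h.eval 0 ^ 2 *
          (res (oddMinus k) h * res (oddPlus k) h * res E h) ^ 2 := by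
      rw [hC]; ring
    rw [e1]
    exact this.mul_right _
  · rw [show (2 : ℤ) ^ 8 = 16 ^ 2 by norm_num]
    exact (pow_dvd_pow_of_dvd (sixteen_dvd_res_odd hx) 2).mul_left _

/-! ### Explicit values for the prime two. -/

lemma IsPrimitiveRoot.prod_range_sub_pow {n : ℕ} (hn : 0 < n) {ζ : ℂ} (hζ : IsPrimitiveRoot ζ n)
    (a : ℂ) : ∏ j ∈ Finset.range n, (a - ζ ^ j) = a ^ n - 1 := by
  have := congrArg (eval a) (X_pow_sub_C_eq_prod hζ hn (one_pow n))
  simpa [eval_prod] using this.symm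

lemma dicyclicMeasure_four_add {n : ℕ} (hn : 0 < n) :
    dicyclicMeasure n (4 + (X - 1)) 0 = (((9 ^ n - 1 ^ n) ^ 2 : ℤ) : ℂ) := by
  have hζ := Complex.isPrimitiveRoot_exp (2 * n) (by lia)
  unfold dicyclicMeasure cyclicMeasure
  generalize Complex.exp (2 * Real.pi * Complex.I / (2 * n : ℕ)) = ζ at hζ ⊢
  have h : ∀ {ω : ℂ}, IsPrimitiveRoot ω (2 * n) →
      ∏ j ∈ Finset.range (2 * n), (-3 - ω ^ j) = 9 ^ n - 1 := fun hω => by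
    rw [hω.prod_range_sub_pow (by lia), pow_mul]; norm_num
  push_cast
  rw [one_pow, sq]
  nth_rewrite 1 [← h hζ]
  rw [← h hζ.inv, ← Finset.prod_mul_distrib]
  refine Finset.prod_congr rfl fun j _ => ?_
  simp only [map_add, map_sub, map_one, aeval_X, map_zero, map_ofNat, inv_pow]
  ring

lemma intDvd_intCast (d k : ℤ) : IntDvd d (k : ℂ) ↔ d ∣ k := by
  unfold IntDvd
  constructor
  · rintro ⟨l, hl⟩; exact ⟨l, Int.cast_injective hl⟩
  · rintro ⟨l, rfl⟩; exact ⟨l, rfl⟩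

/-- Since `9 ≡ 1` modulo 4, lifting the exponent gives `v₂(9ⁿ - 1) = 3 + v₂(n)` for every `n`;
squaring doubles this. -/
lemma intExactPow_four_add {n a : ℕ} (hn : 0 < n) (ha : ExactPow 2 a n) :
    IntExactPow 2 (2 * a + 6) (dicyclicMeasure n (4 + (X - 1)) 0) := by
  rw [dicyclicMeasure_four_add hn]
  unfold IntExactPow
  rw [intDvd_intCast, intDvd_intCast, Nat.cast_ofNat, ← emultiplicity_eq_coe,
    emultiplicity_pow Int.prime_two, Int.two_pow_sub_pow' n (by norm_num) (by norm_num)]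
  have h1 : emultiplicity (2 : ℤ) (9 - 1) = (3 : ℕ) := by
    rw [emultiplicity_eq_coe]; norm_num
  have h2 : emultiplicity (2 : ℤ) n = a := by
    rw [emultiplicity_eq_coe]
    exact ⟨by exact_mod_cast ha.1, by exact_mod_cast ha.2⟩
  rw [h1, h2]
  norm_cast
  ring

lemma prod_range_mul_of_pow_eq_one {r : ℕ} {ω : ℂ} (h : ω ^ r = 1) (φ : ℂ → ℂ) (q : ℕ) :
    ∏ j ∈ Finset.range (q * r), φ (ω ^ j) = (∏ j ∈ Finset.range r, φ (ω ^ j)) ^ q := by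
  induction q with
  | zero => simp
  | succ q ih =>
    rw [add_mul, one_mul, Finset.prod_range_add, ih, pow_succ]
    congr 1
    refine Finset.prod_congr rfl fun j _ => ?_
    rw [pow_add, mul_comm q, pow_mul, h, one_pow, one_mul]

lemma IsPrimitiveRoot.prod_range_pow_add_one {r : ℕ} (hr : Odd r) {ω : ℂ}
    (hω : IsPrimitiveRoot ω r) : ∏ j ∈ Finset.range r, (ω ^ j + 1) = 2 := by
  have h := hω.prod_range_sub_pow hr.pos (-1)
  have e : ∀ j, (-1 : ℂ) - ω ^ j = -1 * (ω ^ j + 1) := fun j => by ring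
  simp only [e] at h
  rw [Finset.prod_mul_distrib, Finset.prod_const, Finset.card_range, hr.neg_one_pow] at h
  linear_combination -h

/-- With `r` the odd part of `n`, `z^{2^{a+1}}` runs through the `r`-th roots of unity, over which
`∏(ω + 1) = 2`. The geometric sum vanishes except at `z = 1`, where it changes the factor 4 into `(2
+ 2mn)² - (2mn)² = 4(1 + 2mn)`. -/
lemma dicyclicMeasure_two_pow {n a : ℕ} (hn : 0 < n) (ha : ExactPow 2 a n) (m : ℤ) :
    dicyclicMeasure n (X ^ 2 ^ (a + 1) + 1 + C m * geomPoly (2 * n)) (C m * geomPoly (2 * n)) =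
      ((2 ^ 2 ^ (a + 2) * (1 + 2 * m * (n : ℤ)) : ℤ) : ℂ) := by
  obtain ⟨⟨r, hr⟩, h2⟩ := ha
  have hro : Odd r := by
    rw [← Nat.not_even_iff_odd, even_iff_two_dvd]
    rintro ⟨s, rfl⟩
    exact h2 ⟨s, by rw [hr]; ring⟩
  have hnr : 2 * n = 2 ^ (a + 1) * r := by rw [hr]; ring
  have hζ := Complex.isPrimitiveRoot_exp (2 * n) (by lia)
  unfold dicyclicMeasure cyclicMeasure
  generalize Complex.exp (2 * Real.pi * Complex.I / (2 * n : ℕ)) = ζ at hζ ⊢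
  have hω : IsPrimitiveRoot (ζ ^ 2 ^ (a + 1)) r := hζ.pow (by lia) hnr
  have hprod : ∀ {ω : ℂ}, IsPrimitiveRoot ω r →
      ∏ j ∈ Finset.range (2 * n), (ω ^ j + 1) = 2 ^ 2 ^ (a + 1) := fun hω => by
    rw [hnr, prod_range_mul_of_pow_eq_one hω.pow_eq_one (fun z => z + 1),
      hω.prod_range_pow_add_one hro]
  have hboth : ∏ j ∈ Finset.range (2 * n), (((ζ ^ 2 ^ (a + 1)) ^ j + 1) *
      (((ζ ^ 2 ^ (a + 1))⁻¹) ^ j + 1)) = 2 ^ 2 ^ (a + 2) := by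
    rw [Finset.prod_mul_distrib, hprod hω, hprod hω.inv, ← pow_add]
    congr 1; ring
  have hgeom : ∀ z : ℂ, z ^ (2 * n) = 1 → z ≠ 1 → aeval z (geomPoly (2 * n)) = 0 := by
    intro z hz h1
    have : (z - 1) * aeval z (geomPoly (2 * n)) = 0 := by
      rw [geomPoly, map_sum, mul_comm]
      simp only [map_pow, aeval_X]
      rw [geom_sum_mul, hz, sub_self]
    exact (mul_eq_zero.mp this).resolve_left (sub_ne_zero.mpr h1)
  have hgeom1 : aeval (1 : ℂ) (geomPoly (2 * n)) = 2 * n := by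
    simp [geomPoly]
  rw [← Nat.sub_add_cancel (show 1 ≤ 2 * n by lia)] at hboth
  push_cast
  rw [← hboth, ← Nat.sub_add_cancel (show 1 ≤ 2 * n by lia), Finset.prod_range_succ',
    Finset.prod_range_succ', Nat.sub_add_cancel (show 1 ≤ 2 * n by lia), mul_assoc]
  congr 1
  · refine Finset.prod_congr rfl fun j hj => ?_
    rw [Finset.mem_range] at hj
    have hz1 : ζ ^ (j + 1) ≠ 1 := hζ.pow_ne_one_of_pos_of_lt (by lia) (by lia)
    have hz : (ζ ^ (j + 1)) ^ (2 * n) = 1 := by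
      rw [← pow_mul, mul_comm, pow_mul, hζ.pow_eq_one, one_pow]
    have g1 := hgeom _ hz hz1
    have g2 := hgeom _ (by rw [inv_pow, hz, inv_one]) (inv_ne_one.mpr hz1)
    simp only [map_add, map_mul, map_pow, map_one, aeval_X, g1, g2, mul_zero, add_zero, sub_zero]
    have e : (ζ ^ (j + 1)) ^ 2 ^ (a + 1) = (ζ ^ 2 ^ (a + 1)) ^ (j + 1) := by
      rw [← pow_mul, mul_comm, pow_mul]
    simp only [inv_pow, e]
  · simp only [pow_zero, inv_one, map_add, map_mul, map_pow, map_one, aeval_X, hgeom1, one_pow,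
      eq_intCast, map_intCast]
    ring

/-! ### The extremal example for odd primes. -/

lemma C_eval_two_add (t : ℤ) (m : ℕ) :
    ∃ k, (Chebyshev.C ℤ m).eval (2 + t) = 2 + (m : ℤ) ^ 2 * t + t ^ 2 * k := by
  induction m using Nat.twoStepInduction with
  | zero => exact ⟨0, by simp⟩
  | one => exact ⟨0, by simp⟩
  | more m ih₁ ih₂ =>
    obtain ⟨k₁, h₁⟩ := ih₁
    obtain ⟨k₂, h₂⟩ := ih₂
    have h := congrArg (eval (2 + t)) (Chebyshev.C_add_two ℤ (m : ℤ))
    push_cast at h₂ ⊢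
    rw [eval_sub, eval_mul, eval_X, h₁, h₂] at h
    exact ⟨((m : ℤ) + 1) ^ 2 + (2 + t) * k₂ - k₁, by rw [h]; ring⟩

/-- First-order expansion at 2; the linear coefficient is `k(k+1)(2k+1)/6`, and multiplying by 6
keeps the recurrence free of fractions. -/
lemma oddMinus_eval_two_add (t : ℤ) (k : ℕ) : ∃ j, 6 * (oddMinus k).eval (2 + t) =
    6 * (2 * k + 1) + t * (k * (k + 1) * (2 * k + 1)) + t ^ 2 * j := by
  induction k using Nat.twoStepInduction with
  | zero => exact ⟨0, by simp [oddMinus]⟩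
  | one => exact ⟨0, by simp [oddMinus]; ring⟩
  | more k ih₁ ih₂ =>
    obtain ⟨k₁, h₁⟩ := ih₁
    obtain ⟨k₂, h₂⟩ := ih₂
    have h := congrArg (eval (2 + t)) (oddMinus_add_two k)
    rw [eval_sub, eval_mul, eval_X] at h
    refine ⟨((k + 1) * (k + 2) * (2 * k + 3) : ℤ) + (2 + t) * k₂ - k₁, ?_⟩
    push_cast at h₁ h₂ ⊢
    rw [h]
    linear_combination (2 + t) * h₂ - h₁

/-- If `t` is divisible by `p` (and, when `p = 3`, `3 + t` is not divisible by `9`), then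
`V(2 + t)` is divisible by `p` exactly once. -/
lemma oddMinus_eval_eq_prime_mul {p k : ℕ} (hp : p.Prime) (hk : p = 2 * k + 1) {t : ℤ}
    (ht : (p : ℤ) ∣ t) (h3 : p = 3 → ¬ 9 ∣ 3 + t) :
    ∃ v, (oddMinus k).eval (2 + t) = p * v ∧ ¬ (p : ℤ) ∣ v := by
  have hpZ : Prime (p : ℤ) := Nat.prime_iff_prime_int.mp hp
  obtain ⟨s, rfl⟩ := ht
  -- For `p = 3` the factor 6 is not invertible, but `V(2+t) = 3 + t` explicitly. For larger `p` the
  -- expansion gives `V(2+t) ≡ p` modulo `p²`.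
  by_cases hp3 : p = 3
  · obtain rfl : k = 1 := by lia
    subst hp3
    refine ⟨1 + s, by simp [oddMinus]; ring, fun ⟨c, hc⟩ => h3 rfl ⟨c, ?_⟩⟩
    push_cast at hc ⊢
    linear_combination 3 * hc
  · obtain ⟨j, hj⟩ := oddMinus_eval_two_add (p * s) k
    have hp6 : ¬ (p : ℤ) ∣ 6 := by
      intro h
      have h6 : p ∣ 2 * 3 := by exact_mod_cast h
      rcases hp.dvd_mul.mp h6 with h | h
      · have := Nat.le_of_dvd (by norm_num) h
        have := hp.two_le
        lia
      · exact hp3 ((Nat.prime_dvd_prime_iff_eq hp Nat.prime_three).mp h)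
    have hpk : (p : ℤ) = 2 * k + 1 := by exact_mod_cast hk
    rw [← hpk] at hj
    have hd : (p : ℤ) ∣ (oddMinus k).eval (2 + p * s) := by
      refine (hpZ.dvd_or_dvd (a := 6) ?_).resolve_left hp6
      exact ⟨6 + p * s * (k * (k + 1)) + p * s ^ 2 * j, by rw [hj]; ring⟩
    obtain ⟨v, hv⟩ := hd
    refine ⟨v, hv, fun ⟨c, hc⟩ => hp6 ⟨6 * c - s * (k * (k + 1)) - s ^ 2 * j, ?_⟩⟩
    rw [hv, hc] at hj
    refine mul_left_cancel₀ hpZ.ne_zero ?_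
    linear_combination -hj

lemma C_prime_eval_two_add {p k : ℕ} (hk : p = 2 * k + 1) (t : ℤ) :
    (Chebyshev.C ℤ p).eval (2 + t) - 2 = t * (oddMinus k).eval (2 + t) ^ 2 := by
  rw [hk, C_two_mul_add_one]
  simp only [eval_add, eval_sub, eval_mul, eval_pow, eval_X, eval_ofNat]
  ring

/-- Each composition with `C_p` multiplies `C - 2` by `V²`, whose valuation is exactly 2. The
condition at 3 matters only at the start, since afterwards `27 ∣ t`. -/
lemma C_prime_pow_eval_two_add {p : ℕ} (hp : p.Prime) (hodd : Odd p) {d : ℤ}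
    (hd : ¬ (p : ℤ) ∣ d) (h3 : p = 3 → ¬ 9 ∣ 3 + p * d) (a : ℕ) :
    ∃ w, (Chebyshev.C ℤ (p ^ a : ℕ)).eval (2 + p * d) = 2 + (p : ℤ) ^ (2 * a + 1) * w ∧
      ¬ (p : ℤ) ∣ w := by
  have hpZ : Prime (p : ℤ) := Nat.prime_iff_prime_int.mp hp
  obtain ⟨k, hk⟩ := hodd
  induction a with
  | zero => exact ⟨d, by simp, hd⟩
  | succ a ih =>
    obtain ⟨w, hw, hwp⟩ := ih
    obtain ⟨v, hv, hvp⟩ := oddMinus_eval_eq_prime_mul hp hk (t := (p : ℤ) ^ (2 * a + 1) * w)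
      ((dvd_pow_self _ (by lia)).mul_right _) (by
        intro hp3
        rcases Nat.eq_zero_or_pos a with rfl | ha
        · have : w = d := by
            refine mul_left_cancel₀ hpZ.ne_zero ?_
            simpa using hw.symm
          rw [this]; simpa using h3 hp3
        · obtain ⟨b, rfl⟩ := Nat.exists_eq_add_of_lt ha
          rintro ⟨c, hc⟩
          have e : (p : ℤ) ^ (2 * (0 + b + 1) + 1) = 9 * (p * p ^ (2 * b)) := by
            rw [hp3]; push_cast; ring
          rw [e] at hc
          have : 9 ∣ (3 : ℤ) := ⟨c - p * p ^ (2 * b) * w, by linear_combination hc⟩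
          norm_num at this)
    refine ⟨w * v ^ 2, ?_, fun h => ?_⟩
    · have h := C_prime_eval_two_add hk ((p : ℤ) ^ (2 * a + 1) * w)
      rw [hv] at h
      rw [pow_succ', Nat.cast_mul, Chebyshev.C_mul, eval_comp, hw]
      linear_combination h
    · exact (hpZ.dvd_or_dvd h).elim hwp fun h => hvp (hpZ.dvd_of_dvd_pow h)

lemma not_pow_dvd_C_eval_sub_two {p : ℕ} (hp : p.Prime) (hodd : Odd p) {d : ℤ}
    (hd : ¬ (p : ℤ) ∣ d) (h3 : p = 3 → ¬ 9 ∣ 3 + p * d) {a n : ℕ} (ha : ExactPow p a n) :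
    ¬ (p : ℤ) ^ (2 * a + 2) ∣ (Chebyshev.C ℤ n).eval (2 + p * d) - 2 := by
  have hpZ : Prime (p : ℤ) := Nat.prime_iff_prime_int.mp hp
  obtain ⟨⟨r, rfl⟩, h2⟩ := ha
  have hr : ¬ (p : ℤ) ∣ r := by
    intro h
    have : p ∣ r := by exact_mod_cast h
    exact h2 (by rw [pow_succ]; exact Nat.mul_dvd_mul_left _ this)
  obtain ⟨w, hw, hwp⟩ := C_prime_pow_eval_two_add hp hodd hd h3 a
  obtain ⟨k, hk⟩ := C_eval_two_add ((p : ℤ) ^ (2 * a + 1) * w) r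
  rw [mul_comm (p ^ a), Nat.cast_mul, Chebyshev.C_mul, eval_comp, hw, hk]
  rintro ⟨c, hc⟩
  have : (p : ℤ) ∣ (r : ℤ) ^ 2 * w := by
    refine ⟨c - (p : ℤ) ^ (2 * a) * w ^ 2 * k, ?_⟩
    refine mul_left_cancel₀ (pow_ne_zero (2 * a + 1) hpZ.ne_zero) ?_
    linear_combination hc
  exact (hpZ.dvd_or_dvd this).elim (fun h => hr (hpZ.dvd_of_dvd_pow h)) hwp

/-- `2ⁿ C_n(c/2)` is an integer although `c/2` need not be. Allowing any ring where 2 is invertible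
lets the identity serve both in `ℂ` and modulo a power of `p`. -/
lemma dickson_one_four_eval {R : Type*} [CommRing R] {u : R} (hu : 2 * u = 1) (c : ℤ) (n : ℕ) :
    (((dickson 1 (4 : ℤ) n).eval c : ℤ) : R) = 2 ^ n * (Chebyshev.C R n).eval (u * c) := by
  induction n using Nat.twoStepInduction with
  | zero => simp only [dickson_zero, Nat.cast_zero, Chebyshev.C_zero]; norm_num
  | one => simp; linear_combination (-(c : R)) * hu
  | more n ih₁ ih₂ =>
    have h := Chebyshev.C_add_two R (n : ℤ)
    rw [dickson_add_two, eval_sub, eval_mul, eval_mul, eval_X, eval_C, Int.cast_sub, Int.cast_mul,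
      Int.cast_mul, ih₁, ih₂]
    push_cast
    rw [h, eval_sub, eval_mul, eval_X]
    linear_combination (-(c : R) * 2 ^ (n + 1) * (Chebyshev.C R (n + 1)).eval (u * c)) * hu

lemma prod_range_two_mul (φ : ℕ → ℂ) (n : ℕ) :
    ∏ j ∈ Finset.range (2 * n), φ j = ∏ i ∈ Finset.range n, (φ (2 * i) * φ (2 * i + 1)) := by
  induction n with
  | zero => simp
  | succ n ih =>
    rw [mul_add, mul_one, Finset.prod_range_succ, Finset.prod_range_succ, ih,
      Finset.prod_range_succ, mul_assoc]

lemma IsPrimitiveRoot.prod_range_sub_add_inv {n : ℕ} (hn : 0 < n) {ζ : ℂ}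
    (hζ : IsPrimitiveRoot ζ n) (s : ℂ) :
    ∏ j ∈ Finset.range n, (s - (ζ ^ j + (ζ ^ j)⁻¹)) = (Chebyshev.C ℂ n).eval s - 2 := by
  obtain ⟨t, ht⟩ := IsAlgClosed.exists_pow_nat_eq (s ^ 2 - 4) (n := 2) (by norm_num)
  have hmul : ((s + t) / 2) * ((s - t) / 2) = 1 := by linear_combination (-1 / 4 : ℂ) * ht
  set z := (s + t) / 2
  have hz0 : z ≠ 0 := left_ne_zero_of_mul_eq_one hmul
  have hs : s = z + z⁻¹ := by rw [inv_eq_of_mul_eq_one_right hmul]; ring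
  have hC := aeval_add_inv_C hz0 n
  rw [Chebyshev.aeval_C] at hC
  have e : ∀ j, s - (ζ ^ j + (ζ ^ j)⁻¹) = z⁻¹ * ((z - ζ ^ j) * (z - ζ⁻¹ ^ j)) := fun j => by
    rw [hs, inv_pow]
    have h1 := mul_inv_cancel₀ (pow_ne_zero j (hζ.ne_zero hn.ne'))
    have h2 := mul_inv_cancel₀ hz0
    linear_combination (-z + ζ ^ j + (ζ ^ j)⁻¹) * h2 - z⁻¹ * h1
  simp only [e]
  rw [Finset.prod_mul_distrib, Finset.prod_mul_distrib, hζ.prod_range_sub_pow hn,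
    hζ.inv.prod_range_sub_pow hn, Finset.prod_const, Finset.card_range, hs, hC]
  have h3 : z⁻¹ ^ n * z ^ n = 1 := by rw [← mul_pow, inv_mul_cancel₀ hz0, one_pow]
  linear_combination (z ^ n - 2) * h3

/-- Where `zⁿ = -1` the factor is 1. Where `zⁿ = 1` one has `f = 2z - 1` and `g = p - 1`, so the
factor is `4 + 2p - p² - 2(z + z⁻¹)`. -/
lemma dicyclicMeasure_odd_example {n p : ℕ} (hn : 0 < n) (hp : Odd p) :
    dicyclicMeasure n (1 - (1 + X ^ n) * (1 - X)) (C (((p : ℤ) - 1) / 2) * (1 + X ^ n)) =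
      (((dickson 1 (4 : ℤ) n).eval (4 + 2 * (p : ℤ) - (p : ℤ) ^ 2) - 2 ^ (n + 1) : ℤ) : ℂ) := by
  obtain ⟨k, hk⟩ := hp
  have hhalf : ((p : ℤ) - 1) / 2 = k := by rw [hk]; push_cast; lia
  have hζ := Complex.isPrimitiveRoot_exp (2 * n) (by lia)
  unfold dicyclicMeasure cyclicMeasure
  generalize Complex.exp (2 * Real.pi * Complex.I / (2 * n : ℕ)) = ζ at hζ ⊢
  have hζn := hζ.pow_half_eq_neg_one hn
  have hξ : IsPrimitiveRoot (ζ ^ 2) n := hζ.pow (by lia) rfl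
  rw [Int.cast_sub, dickson_one_four_eval (u := (1 / 2 : ℂ)) (by norm_num), prod_range_two_mul,
    hhalf]
  have h := hξ.prod_range_sub_add_inv hn (1 / 2 * ((4 + 2 * p - p ^ 2 : ℤ) : ℂ))
  rw [show (2 : ℂ) ^ n * (Chebyshev.C ℂ n).eval (1 / 2 * ((4 + 2 * p - p ^ 2 : ℤ) : ℂ)) -
      ((2 ^ (n + 1) : ℤ) : ℂ) = 2 ^ n * ((Chebyshev.C ℂ n).eval
        (1 / 2 * ((4 + 2 * p - p ^ 2 : ℤ) : ℂ)) - 2) by push_cast; ring, ← h]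
  rw [show (2 : ℂ) ^ n = ∏ _i ∈ Finset.range n, 2 by simp, ← Finset.prod_mul_distrib]
  refine Finset.prod_congr rfl fun i _ => ?_
  have e1 : (ζ ^ (2 * i)) ^ n = 1 := by
    rw [← pow_mul, mul_comm, pow_mul, hζn, pow_mul, neg_one_sq, one_pow]
  have e2 : (ζ ^ (2 * i + 1)) ^ n = -1 := by
    rw [pow_succ, mul_pow, e1, hζn, one_mul]
  have e3 := mul_inv_cancel₀ (pow_ne_zero (2 * i) (hζ.ne_zero (by lia)))
  simp only [map_add, map_sub, map_mul, map_pow, map_one, aeval_X, inv_pow, e1, e2,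
    eq_intCast, map_intCast, inv_one, ← pow_mul]
  have hpk : (p : ℂ) = 2 * k + 1 := by rw [hk]; push_cast; ring
  push_cast
  rw [hpk, inv_neg, inv_one]
  linear_combination 4 * e3

theorem intExactPow_odd_example {n p a : ℕ} (hn : 0 < n) (hp : p.Prime) (hodd : Odd p)
    (ha : ExactPow p a n) (hlow : ∀ f g : ℤ[X], IntDvd (p : ℤ) (dicyclicMeasure n f g) →
      IntDvd ((p : ℤ) ^ (2 * a + 1)) (dicyclicMeasure n f g)) :
    IntExactPow p (2 * a + 1)
      (dicyclicMeasure n (1 - (1 + X ^ n) * (1 - X)) (C (((p : ℤ) - 1) / 2) * (1 + X ^ n))) := by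
  have hpZ : Prime (p : ℤ) := Nat.prime_iff_prime_int.mp hp
  have hp2 : ¬ (p : ℤ) ∣ 2 := fun h => by
    have h2 : p ∣ 2 := by exact_mod_cast h
    rw [Nat.prime_dvd_prime_iff_eq hp Nat.prime_two] at h2
    subst h2; exact absurd hodd (by decide)
  set q := p ^ (2 * a + 2) with hq
  obtain ⟨l, hl⟩ : Odd q := hodd.pow
  -- `u = (q + 1)/2` inverts 2 modulo `q = p^{2a+2}`, so `s = (4 + 2p - p²)/2` becomes the integer
  -- `2 + p d` modulo `q`, precise enough to exclude divisibility by `q`.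
  set u : ℤ := l + 1 with hu
  have hqZ : (2 * u : ℤ) = q + 1 := by rw [hu, hl]; push_cast; ring
  have huq : (2 * (u : ZMod q) : ZMod q) = 1 := by
    have := congrArg (Int.cast : ℤ → ZMod q) hqZ
    push_cast at this
    rwa [ZMod.natCast_self, zero_add] at this
  set d : ℤ := u * (2 - p) with hd
  set K := (dickson 1 (4 : ℤ) n).eval (4 + 2 * (p : ℤ) - (p : ℤ) ^ 2) - 2 ^ (n + 1) with hK
  have hcong : (q : ℤ) ∣ K - 2 ^ n * ((Chebyshev.C ℤ n).eval (2 + p * d) - 2) := by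
    rw [← ZMod.intCast_zmod_eq_zero_iff_dvd, hK, Int.cast_sub,
      Int.cast_sub _ (2 ^ (n + 1)), dickson_one_four_eval huq]
    have e : (u : ZMod q) * ((4 + 2 * p - p ^ 2 : ℤ) : ZMod q) = ((2 + p * d : ℤ) : ZMod q) := by
      rw [hd]; push_cast; linear_combination 2 * huq
    have e' : (((Chebyshev.C ℤ n).eval (2 + p * d) : ℤ) : ZMod q) =
        (Chebyshev.C (ZMod q) n).eval ((2 + p * d : ℤ) : ZMod q) :=
      Chebyshev.algebraMap_eval_C (R' := ZMod q) (2 + p * d) n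
    rw [e, Int.cast_mul, Int.cast_sub, e']
    push_cast
    ring
  have hpq : (p : ℤ) ∣ q := by rw [hq]; exact_mod_cast dvd_pow_self p (by lia)
  have hpd : (p : ℤ) ∣ (Chebyshev.C ℤ n).eval (2 + p * d) - 2 := by
    have := sub_dvd_eval_sub (2 + p * d) 2 (Chebyshev.C ℤ n)
    rw [Chebyshev.C_eval_two, add_sub_cancel_left] at this
    exact (dvd_mul_right _ _).trans this
  have hpK : (p : ℤ) ∣ K := (dvd_iff_dvd_of_dvd_sub (hpq.trans hcong)).mpr (hpd.mul_left _)
  have h1 := hlow _ _ (by rw [dicyclicMeasure_odd_example hn hodd, intDvd_intCast]; exact hpK)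
  refine ⟨h1, ?_⟩
  rw [dicyclicMeasure_odd_example hn hodd, intDvd_intCast, ← hK]
  intro h2
  have h3 : ((p : ℤ) ^ (2 * a + 2)) ∣ 2 ^ n * ((Chebyshev.C ℤ n).eval (2 + p * d) - 2) := by
    rw [hq] at hcong
    push_cast at hcong
    exact (dvd_iff_dvd_of_dvd_sub hcong).mp h2
  have hcop : IsCoprime ((p : ℤ) ^ (2 * a + 2)) (2 ^ n) :=
    (hpZ.irreducible.coprime_iff_not_dvd.mpr hp2).pow
  have hud : ¬ (p : ℤ) ∣ u := fun h => by
    have h4 : (p : ℤ) ∣ 1 := (dvd_add_right hpq).mp (hqZ ▸ h.mul_left 2)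
    exact hpZ.not_dvd_one h4
  refine not_pow_dvd_C_eval_sub_two hp hodd (d := d) ?_ ?_ ha (hcop.dvd_of_dvd_mul_left h3)
  · rw [hd, hpZ.dvd_mul]
    rintro (h | h)
    · exact hud h
    · exact hp2 ((dvd_sub_left (dvd_refl _)).mp h)
  · intro hp3 h9
    obtain ⟨c, hc⟩ := hpq
    rw [hd] at h9
    subst hp3
    push_cast at *
    lia

/-! ### Transfer to the complex-valued measure and conclusion. -/

theorem intDvd_odd_prime {n p a : ℕ} (hn : 0 < n) (hp : p.Prime) (ha : p ^ a ∣ n) (f g : ℤ[X])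
    (h : IntDvd (p : ℤ) (dicyclicMeasure n f g)) :
    IntDvd ((p : ℤ) ^ (2 * a + 1)) (dicyclicMeasure n f g) := by
  have := Fact.mk hp
  obtain ⟨A, B, A', B', h1, h2, h3, h4, hM⟩ := dicyclicMeasure_eq hn f g
  rw [h1, h2, h3, h4] at hM
  rw [hM, intDvd_intCast] at h ⊢
  exact prime_pow_dvd_measure p hn ha A B A' B' rfl h

theorem intDvd_two_of_odd {n : ℕ} (hn : Odd n) (f g : ℤ[X])
    (h : IntDvd 2 (dicyclicMeasure n f g)) : IntDvd (2 ^ 4) (dicyclicMeasure n f g) := by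
  obtain ⟨A, B, A', B', h1, h2, h3, h4, hM⟩ := dicyclicMeasure_eq hn.pos f g
  rw [h1, h2, h3, h4] at hM
  rw [hM, intDvd_intCast] at h ⊢
  exact two_pow_four_dvd_measure hn A B A' B' _ rfl h

theorem intDvd_two_of_even {n a : ℕ} (hn : 0 < n) (ha : ExactPow 2 a n) (ha1 : 1 ≤ a)
    (f g : ℤ[X]) (h : IntDvd 2 (dicyclicMeasure n f g)) :
    IntDvd (2 ^ (2 * a + 6)) (dicyclicMeasure n f g) := by
  obtain ⟨⟨r, hr⟩, ha2⟩ := ha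
  obtain ⟨k, hk⟩ : Odd r := by
    rw [← Nat.not_even_iff_odd, even_iff_two_dvd]
    rintro ⟨s, rfl⟩
    exact ha2 ⟨s, by rw [hr]; ring⟩
  obtain ⟨b, rfl⟩ := Nat.exists_eq_add_of_le' ha1
  obtain ⟨A, B, A', B', h1, h2, h3, h4, hM⟩ := dicyclicMeasure_eq hn f g
  rw [h1, h2, h3, h4] at hM
  rw [hM, intDvd_intCast] at h ⊢
  exact two_pow_dvd_measure A B A' B' (by rw [hr, hk]) rfl h

lemma IntDvd.of_dvd {d e : ℤ} {z : ℂ} (h : IntDvd e z) (hd : d ∣ e) : IntDvd d z := by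
  obtain ⟨k, rfl⟩ := h
  rw [intDvd_intCast]
  exact hd.mul_right k

/-- An exact power attained by a value of the measure bounds all valid exponents. -/
lemma le_of_intExactPow {n p e₀ : ℕ} {f₀ g₀ : ℤ[X]} (he₀ : e₀ ≠ 0)
    (h₀ : IntExactPow p e₀ (dicyclicMeasure n f₀ g₀)) (e : ℕ)
    (h : ∀ f g : ℤ[X], IntDvd (p : ℤ) (dicyclicMeasure n f g) →
      IntDvd ((p : ℤ) ^ e) (dicyclicMeasure n f g)) : e ≤ e₀ := by
  by_contra! hlt
  exact h₀.2 ((h f₀ g₀ (h₀.1.of_dvd (dvd_pow_self _ he₀))).of_dvd (pow_dvd_pow _ hlt))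

theorem mainTheorem3 (n : ℕ) (hn : 0 < n) :
    -- the dicyclic measure takes rational integer values
    (∀ f g : ℤ[X], ∃ k : ℤ, dicyclicMeasure n f g = (k : ℂ)) ∧
    -- odd primes
    (∀ p α : ℕ, p.Prime → Odd p → ExactPow p α n →
      (∀ f g : ℤ[X], IntDvd (p : ℤ) (dicyclicMeasure n f g) →
        IntDvd ((p : ℤ) ^ (2 * α + 1)) (dicyclicMeasure n f g)) ∧
      IntExactPow p (2 * α + 1)
        (dicyclicMeasure n (1 - (1 + X ^ n) * (1 - X)) (C (((p : ℤ) - 1) / 2) * (1 + X ^ n))) ∧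
      (∀ e : ℕ, (∀ f g : ℤ[X], IntDvd (p : ℤ) (dicyclicMeasure n f g) →
        IntDvd ((p : ℤ) ^ e) (dicyclicMeasure n f g)) → e ≤ 2 * α + 1)) ∧
    -- the prime two
    (∀ α : ℕ, ExactPow 2 α n →
      (α = 0 →
        (∀ f g : ℤ[X], IntDvd 2 (dicyclicMeasure n f g) →
          IntDvd (2 ^ 4) (dicyclicMeasure n f g)) ∧
        (∀ e : ℕ, (∀ f g : ℤ[X], IntDvd 2 (dicyclicMeasure n f g) →
          IntDvd (2 ^ e) (dicyclicMeasure n f g)) → e ≤ 4)) ∧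
      (1 ≤ α →
        (∀ f g : ℤ[X], IntDvd 2 (dicyclicMeasure n f g) →
          IntDvd (2 ^ (2 * α + 6)) (dicyclicMeasure n f g)) ∧
        (∀ e : ℕ, (∀ f g : ℤ[X], IntDvd 2 (dicyclicMeasure n f g) →
          IntDvd (2 ^ e) (dicyclicMeasure n f g)) → e ≤ 2 * α + 6)) ∧
      (∀ m : ℤ, dicyclicMeasure n (X ^ 2 ^ (α + 1) + 1 + C m * geomPoly (2 * n))
          (C m * geomPoly (2 * n)) =
        ((2 ^ 2 ^ (α + 2) * (1 + 2 * m * (n : ℤ)) : ℤ) : ℂ)) ∧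
      IntExactPow 2 (2 * α + 6) (dicyclicMeasure n (4 + (X - 1)) 0)) := by 
  refine ⟨fun f g => ?_, fun p a hp hodd ha => ?_, fun a ha => ⟨fun ha0 => ?_, fun ha1 => ?_,
    dicyclicMeasure_two_pow hn ha, intExactPow_four_add hn ha⟩⟩
  · obtain ⟨A, B, A', B', -, -, -, -, hM⟩ := dicyclicMeasure_eq hn f g
    exact ⟨_, hM⟩
  · have hlow := intDvd_odd_prime hn hp ha.1
    have hex := intExactPow_odd_example hn hp hodd ha hlow
    exact ⟨hlow, hex, le_of_intExactPow (by lia) hex⟩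
  · subst ha0
    have hodd : Odd n := by
      rw [← Nat.not_even_iff_odd, even_iff_two_dvd]
      simpa using ha.2
    -- The case `m = 0`, `α = 0` of the explicit family has measure exactly `2^4`.
    refine ⟨intDvd_two_of_odd hodd, le_of_intExactPow (p := 2) (e₀ := 4) (by lia)
      (f₀ := X ^ 2 ^ (0 + 1) + 1 + C 0 * geomPoly (2 * n)) (g₀ := C 0 * geomPoly (2 * n)) ?_⟩
    rw [dicyclicMeasure_two_pow hn ha]
    unfold IntExactPow
    rw [intDvd_intCast, intDvd_intCast]
    norm_num
  · exact ⟨intDvd_two_of_even hn ha ha1, le_of_intExactPow (p := 2) (by lia)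
      (intExactPow_four_add hn ha)⟩
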